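/- Let $k$ be an algebraically closed field of characteristic $0$ and let $N>1$ be an odd integer. For a primitive $N$-th root of unity $q\in k$, let $u_q(\mathfrak{sl}_2)$ be the Hopf algebra over $k$ generated as an algebra by $E,F,K$ with relations $$E^N=F^N=0,\quad K^N=1,\quad KE=q^2EK,\quad KF=q^{-2}FK,\quad EF-FE=\frac{K-K^{N-1}}{q-q^{-1}},$$ with $\Delta(E)=E\otimes 1+K\otimes E$, $\Delta(F)=F\otimes K^{-1}+1\otimes F$, $\Delta(K)=K\otimes K$, $\varepsilon(E)=\varepsilon(F)=0$, $\varepsilon(K)=1$, $S(E)=-K^{-1}E$, $S(F)=-FK$, $S(K)=K^{-1}$. For a finite-dimensional Hopf algebra $H$ and $n\ge 1$, the $n$-th indicator is $\nu_n(H)=\operatorname{Tr}(S\circ P^{(n-1)}\colon H\to H)$, where $P^{(m)}(h)=h_{(1)}\cdots h_{(m)}$ (and $P^{(0)}(h)=\varepsilon(h)1$) is the $m$-th convolution power of $\mathrm{id}_H$; in particular $\nu_2(H)=\operatorname{Tr}(S)$. Two Hopf algebras $H,H'$ are gauge equivalent if $H'\cong H_F=(H,\,\Delta_F=F\Delta(-)F^{-1},\,\varepsilon)$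 for some invertible $F\in H\otimes H$ with $(\varepsilon\otimes\mathrm{id})(F)=1=(\mathrm{id}\otimes\varepsilon)(F)$ and $(F\otimes1)(\Delta\otimes\mathrm{id})(F)=(1\otimes F)(\mathrm{id}\otimes\Delta)(F)$. Then for all primitive $N$-th roots of unity $p,q\in k$: 1. $u_q(\mathfrak{sl}_2)$ is finite-dimensional and $\nu_2(u_q(\mathfrak{sl}_2))=\dfrac{4}{(1+q)(1+q^{-1})}$. 2. The following are equivalent: $u_p(\mathfrak{sl}_2)$ and $u_q(\mathfrak{sl}_2)$ are gauge equivalent; $u_p(\mathfrak{sl}_2)$ and $u_q(\mathfrak{sl}_2)$ are isomorphic as Hopf algebras; $p=q$ or $p=q^{-1}$. -/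

import Mathlib

open scoped TensorProduct

noncomputable section

/-! ### Hopf-algebraic notions -/

section HopfNotions

variable (k : Type*) [Field k]

/-- The `m`-th Sweedler power map `h ↦ h₍₁₎ ⋯ h₍ₘ₎` (and `h ↦ ε(h) 1` for `m = 0`): the `m`-th
power of the identity for the convolution product. -/
def sweedlerPower (H : Type*) [Ring H] [HopfAlgebra k H] (m : ℕ) : H →ₗ[k] H :=
  ((WithConv.toConv (LinearMap.id : H →ₗ[k] H)) ^ m).ofConv

/-- The `n`-th indicator `ν_n(H) = Tr (S ∘ P^{(n-1)})`, for `n ≥ 1` and `H` finite-dimensional. -/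
def hopfIndicator (H : Type*) [Ring H] [HopfAlgebra k H] (n : ℕ) : k :=
  LinearMap.trace k H (HopfAlgebra.antipode k ∘ₗ sweedlerPower k H (n - 1))

/-- An invertible element `F` of `H ⊗ H` is a (Drinfeld) twist if
`(ε ⊗ id)(F) = 1 = (id ⊗ ε)(F)` and
`(F ⊗ 1) (Δ ⊗ id)(F) = (1 ⊗ F) (id ⊗ Δ)(F)` in `H ⊗ (H ⊗ H)`. -/
structure IsDrinfeldTwist {H : Type*} [Ring H] [HopfAlgebra k H] (F : (H ⊗[k] H)ˣ) : Prop where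
  counit_left : Algebra.TensorProduct.lid k H
    (Algebra.TensorProduct.map (Bialgebra.counitAlgHom k H) (AlgHom.id k H) (F : H ⊗[k] H)) = 1
  counit_right : Algebra.TensorProduct.rid k k H
    (Algebra.TensorProduct.map (AlgHom.id k H) (Bialgebra.counitAlgHom k H) (F : H ⊗[k] H)) = 1
  cocycle :
    Algebra.TensorProduct.assoc k k k H H H
      (((F : H ⊗[k] H) ⊗ₜ[k] (1 : H)) *
        Algebra.TensorProduct.map (Bialgebra.comulAlgHom k H) (AlgHom.id k H) (F : H ⊗[k] H)) =
    ((1 : H) ⊗ₜ[k] (F : H ⊗[k] H)) *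
      Algebra.TensorProduct.map (AlgHom.id k H) (Bialgebra.comulAlgHom k H) (F : H ⊗[k] H)

/-- The twisted comultiplication `Δ_F(h) = F Δ(h) F⁻¹`. -/
def twistedComul {H : Type*} [Ring H] [HopfAlgebra k H] (F : (H ⊗[k] H)ˣ) (h : H) : H ⊗[k] H :=
  (F : H ⊗[k] H) * Coalgebra.comul h * ((F⁻¹ : (H ⊗[k] H)ˣ) : H ⊗[k] H)

/-- `H` and `H'` are gauge equivalent if `H' ≅ H_F = (H, Δ_F, ε)` for some twist `F` of `H`.
(An isomorphism of bialgebras between Hopf algebras automatically preserves antipodes.) -/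
def GaugeEquivalent (H H' : Type*) [Ring H] [HopfAlgebra k H] [Ring H'] [HopfAlgebra k H'] :
    Prop :=
  ∃ F : (H ⊗[k] H)ˣ, IsDrinfeldTwist k F ∧
    ∃ φ : H' ≃ₐ[k] H,
      (∀ x : H', Coalgebra.counit (R := k) (φ x) = Coalgebra.counit (R := k) x) ∧
      (∀ x : H', twistedComul k F (φ x) =
        Algebra.TensorProduct.map (φ : H' →ₐ[k] H) (φ : H' →ₐ[k] H) (Coalgebra.comul x))

/-- `H` and `H'` are isomorphic as Hopf algebras: there is an isomorphism of algebras and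
coalgebras that commutes with the antipodes. -/
def HopfIsomorphic (H H' : Type*) [Ring H] [HopfAlgebra k H] [Ring H'] [HopfAlgebra k H'] :
    Prop :=
  ∃ e : H ≃ₐc[k] H', ∀ x : H, e (HopfAlgebra.antipode k x) = HopfAlgebra.antipode k (e x)

end HopfNotions

/-! ### Powers of a sum of two `q`-commuting elements -/

section QBinomial

/-- Gaussian binomial coefficients, through the `q`-Pascal rule. -/
def gaussChoose {k : Type*} [Field k] (w : k) : ℕ → ℕ → k
  | _, 0 => 1
  | 0, _ + 1 => 0
  | n + 1, j + 1 => gaussChoose w n j + w ^ (j + 1) * gaussChoose w n (j + 1)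

theorem gaussChoose_mul {k : Type*} [Field k] (w : k) (n : ℕ) : ∀ j : ℕ,
    (w ^ (j + 1) - 1) * gaussChoose w (n + 1) (j + 1) = (w ^ (n + 1) - 1) * gaussChoose w n j := by
  induction n with
  | zero =>
    intro j
    cases j with
    | zero => simp [gaussChoose]
    | succ j => simp [gaussChoose]
  | succ n ih =>
    intro j
    cases j with
    | zero =>
      have h := ih 0
      simp only [gaussChoose] at h ⊢
      linear_combination w * h
    | succ j =>
      have h1 := ih (j + 1)
      have h2 := ih j
      rw [show gaussChoose w (n + 1 + 1) (j + 1 + 1) = gaussChoose w (n + 1) (j + 1)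
        + w ^ (j + 1 + 1) * gaussChoose w (n + 1) (j + 1 + 1) from rfl]
      have h3 : gaussChoose w (n + 1) (j + 1) = gaussChoose w n j
        + w ^ (j + 1) * gaussChoose w n (j + 1) := rfl
      linear_combination w ^ (j + 2) * h1 + w * h2 - w * (w ^ (n + 1) - 1) * h3

theorem gaussChoose_eq_zero_of_lt {k : Type*} [Field k] (w : k) (n : ℕ) : ∀ j : ℕ, n < j →
    gaussChoose w n j = 0 := by
  induction n with
  | zero =>
    intro j hj
    obtain ⟨j, rfl⟩ : ∃ i, j = i + 1 := ⟨j - 1, by omega⟩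
    rfl
  | succ n ih =>
    intro j hj
    obtain ⟨j, rfl⟩ : ∃ i, j = i + 1 := ⟨j - 1, by omega⟩
    simp [gaussChoose, ih j (by omega), ih (j + 1) (by omega)]

theorem gaussChoose_self {k : Type*} [Field k] (w : k) (n : ℕ) : gaussChoose w n n = 1 := by
  induction n with
  | zero => rfl
  | succ n ih => simp [gaussChoose, ih, gaussChoose_eq_zero_of_lt]

theorem gaussChoose_zero_right {k : Type*} [Field k] (w : k) (n : ℕ) :
    gaussChoose w n 0 = 1 := by
  cases n <;> rfl

theorem qCommute_pow {k A : Type*} [Field k] [Ring A] [Algebra k A] {w : k} {a b : A}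
    (h : b * a = w • (a * b)) (n : ℕ) : b * a ^ n = w ^ n • (a ^ n * b) := by
  induction n with
  | zero => simp
  | succ n ih =>
    rw [pow_succ, ← mul_assoc, ih, smul_mul_assoc, mul_assoc, h, mul_smul_comm, smul_smul,
      ← mul_assoc, pow_succ]

theorem qBinomial {k A : Type*} [Field k] [Ring A] [Algebra k A] {w : k} {a b : A}
    (h : b * a = w • (a * b)) (n : ℕ) :
    (a + b) ^ n = ∑ j ∈ Finset.range (n + 1), gaussChoose w n j • (a ^ j * b ^ (n - j)) := by
  induction n with
  | zero => simp [gaussChoose]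
  | succ n ih =>
    have hb : ∀ j ∈ Finset.range (n + 1), b * (gaussChoose w n j • (a ^ j * b ^ (n - j)))
        = (w ^ j * gaussChoose w n j) • (a ^ j * b ^ (n + 1 - j)) := by
      intro j hj
      have hj' : j ≤ n := by simpa [Nat.lt_succ_iff] using hj
      rw [mul_smul_comm, ← mul_assoc, qCommute_pow h, smul_mul_assoc, smul_smul, mul_assoc,
        ← pow_succ', mul_comm, Nat.sub_add_comm hj']
    have ha : ∀ j ∈ Finset.range (n + 1), a * (gaussChoose w n j • (a ^ j * b ^ (n - j)))
        = gaussChoose w n j • (a ^ (j + 1) * b ^ (n + 1 - (j + 1))) := by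
      intro j _
      rw [mul_smul_comm, ← mul_assoc, ← pow_succ', Nat.add_sub_add_right]
    rw [pow_succ', ih, add_mul, Finset.mul_sum, Finset.mul_sum, Finset.sum_congr rfl ha,
      Finset.sum_congr rfl hb, Finset.sum_range_succ' _ (n + 1)]
    have h2 : ∑ j ∈ Finset.range (n + 1), (w ^ j * gaussChoose w n j) • (a ^ j * b ^ (n + 1 - j))
        = ∑ j ∈ Finset.range (n + 2), (w ^ j * gaussChoose w n j) • (a ^ j * b ^ (n + 1 - j)) := by
      rw [Finset.sum_range_succ _ (n + 1), gaussChoose_eq_zero_of_lt w n (n + 1) (by omega)]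
      simp
    rw [h2, Finset.sum_range_succ' _ (n + 1), ← add_assoc, ← Finset.sum_add_distrib]
    congr 1
    · refine Finset.sum_congr rfl fun j _ => ?_
      rw [← add_smul]
      rfl
    · simp [gaussChoose_zero_right]

theorem add_pow_eq_zero_of_qCommute {k A : Type*} [Field k] [Ring A] [Algebra k A] {w : k}
    {N : ℕ} (hN : 0 < N) (hw : IsPrimitiveRoot w N) {a b : A} (h : b * a = w • (a * b))
    (ha : a ^ N = 0) (hb : b ^ N = 0) : (a + b) ^ N = 0 := by
  rw [qBinomial h]
  refine Finset.sum_eq_zero fun j hj => ?_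
  rcases Nat.eq_zero_or_pos j with rfl | hj0
  · simp [hb]
  rcases Nat.lt_or_ge j N with hjN | hjN
  · obtain ⟨i, rfl⟩ : ∃ i, j = i + 1 := ⟨j - 1, by omega⟩
    obtain ⟨M, rfl⟩ : ∃ M, N = M + 1 := ⟨N - 1, by omega⟩
    have h1 := gaussChoose_mul w M i
    rw [hw.pow_eq_one, sub_self, zero_mul] at h1
    have h2 : w ^ (i + 1) - 1 ≠ 0 :=
      sub_ne_zero.mpr (hw.pow_ne_one_of_pos_of_lt (by omega) hjN)
    rw [(mul_eq_zero.mp h1).resolve_left h2, zero_smul]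
  · have : j = N := by
      have := Finset.mem_range.mp hj
      omega
    subst this
    simp [ha]

end QBinomial

/-! ### The small quantum group `u_q(sl₂)` -/

/-- The three generators. -/
inductive Sl2Gen : Type
  | E | F | K

/-- The defining relations of `u_q(sl₂)`, where `N` is the order of `q`. -/
inductive Sl2Rel {k : Type*} [Field k] (q : k) (N : ℕ) :
    FreeAlgebra k Sl2Gen → FreeAlgebra k Sl2Gen → Prop
  | E_pow : Sl2Rel q N (FreeAlgebra.ι k Sl2Gen.E ^ N) 0
  | F_pow : Sl2Rel q N (FreeAlgebra.ι k Sl2Gen.F ^ N) 0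
  | K_pow : Sl2Rel q N (FreeAlgebra.ι k Sl2Gen.K ^ N) 1
  | K_E : Sl2Rel q N (FreeAlgebra.ι k Sl2Gen.K * FreeAlgebra.ι k Sl2Gen.E)
      (q ^ 2 • (FreeAlgebra.ι k Sl2Gen.E * FreeAlgebra.ι k Sl2Gen.K))
  | K_F : Sl2Rel q N (FreeAlgebra.ι k Sl2Gen.K * FreeAlgebra.ι k Sl2Gen.F)
      ((q ^ 2)⁻¹ • (FreeAlgebra.ι k Sl2Gen.F * FreeAlgebra.ι k Sl2Gen.K))
  | E_F : Sl2Rel q N (FreeAlgebra.ι k Sl2Gen.E * FreeAlgebra.ι k Sl2Gen.F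
        - FreeAlgebra.ι k Sl2Gen.F * FreeAlgebra.ι k Sl2Gen.E)
      ((q - q⁻¹)⁻¹ • (FreeAlgebra.ι k Sl2Gen.K - FreeAlgebra.ι k Sl2Gen.K ^ (N - 1)))

/-- `u_q(sl₂)` for a root of unity `q` of odd order `N`. The two proofs are arguments of the type
so that the Hopf algebra structure below is found by instance search. -/
def SmallQuantumSl2 {k : Type*} [Field k] {q : k} {N : ℕ} (_hN : Odd N)
    (_hq : IsPrimitiveRoot q N) : Type _ :=
  RingQuot (Sl2Rel q N)

namespace SmallQuantumSl2

section Algebra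

variable {k : Type*} [Field k] {q : k} {N : ℕ} (hN : Odd N) (hq : IsPrimitiveRoot q N)

instance instRing : Ring (SmallQuantumSl2 hN hq) :=
  inferInstanceAs (Ring (RingQuot (Sl2Rel q N)))

instance instAlgebra : Algebra k (SmallQuantumSl2 hN hq) :=
  inferInstanceAs (Algebra k (RingQuot (Sl2Rel q N)))

/-- The quotient map from the free algebra on the generators. -/
def mk : FreeAlgebra k Sl2Gen →ₐ[k] SmallQuantumSl2 hN hq :=
  RingQuot.mkAlgHom k (Sl2Rel q N)

/-- The generators of `u_q(sl₂)`. -/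
def gen (x : Sl2Gen) : SmallQuantumSl2 hN hq := mk hN hq (FreeAlgebra.ι k x)

/-- The generator `E`. -/
abbrev E : SmallQuantumSl2 hN hq := gen hN hq Sl2Gen.E
/-- The generator `F`. -/
abbrev F : SmallQuantumSl2 hN hq := gen hN hq Sl2Gen.F
/-- The generator `K`. -/
abbrev K : SmallQuantumSl2 hN hq := gen hN hq Sl2Gen.K
/-- The inverse `K⁻¹ = K^{N-1}` of `K`. -/
abbrev Kinv : SmallQuantumSl2 hN hq := K hN hq ^ (N - 1)

theorem mk_rel {x y : FreeAlgebra k Sl2Gen} (h : Sl2Rel q N x y) : mk hN hq x = mk hN hq y :=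
  RingQuot.mkAlgHom_rel k h

theorem E_pow : E hN hq ^ N = 0 := by
  simpa [gen] using mk_rel hN hq Sl2Rel.E_pow

theorem F_pow : F hN hq ^ N = 0 := by
  simpa [gen] using mk_rel hN hq Sl2Rel.F_pow

theorem K_pow : K hN hq ^ N = 1 := by
  simpa [gen] using mk_rel hN hq Sl2Rel.K_pow

theorem K_mul_E : K hN hq * E hN hq = q ^ 2 • (E hN hq * K hN hq) := by
  simpa [gen] using mk_rel hN hq Sl2Rel.K_E

theorem K_mul_F : K hN hq * F hN hq = (q ^ 2)⁻¹ • (F hN hq * K hN hq) := by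
  simpa [gen] using mk_rel hN hq Sl2Rel.K_F

theorem E_mul_F : E hN hq * F hN hq - F hN hq * E hN hq
    = (q - q⁻¹)⁻¹ • (K hN hq - Kinv hN hq) := by
  simpa [gen, Kinv] using mk_rel hN hq Sl2Rel.E_F

theorem K_mul_Kinv : K hN hq * Kinv hN hq = 1 := by
  rw [Kinv, ← pow_succ', Nat.sub_add_cancel hN.pos, K_pow]

theorem Kinv_mul_K : Kinv hN hq * K hN hq = 1 := by
  rw [Kinv, ← pow_succ, Nat.sub_add_cancel hN.pos, K_pow]

theorem Kinv_pow : Kinv hN hq ^ (N - 1) = K hN hq := by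
  have h : Kinv hN hq ^ N = 1 := by rw [Kinv, ← pow_mul, mul_comm, pow_mul, K_pow, one_pow]
  calc Kinv hN hq ^ (N - 1) = Kinv hN hq ^ (N - 1) * (Kinv hN hq * K hN hq) := by
        rw [Kinv_mul_K, mul_one]
    _ = Kinv hN hq ^ (N - 1 + 1) * K hN hq := by rw [← mul_assoc, ← pow_succ]
    _ = K hN hq := by rw [Nat.sub_add_cancel hN.pos, h, one_mul]

theorem q_ne_zero {k : Type*} [Field k] {q : k} {N : ℕ} (hN : Odd N)
    (hq : IsPrimitiveRoot q N) : q ≠ 0 := hq.ne_zero hN.pos.ne'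

theorem Kinv_mul_E : Kinv hN hq * E hN hq = (q ^ 2)⁻¹ • (E hN hq * Kinv hN hq) := by
  have h0 : q ^ 2 ≠ 0 := pow_ne_zero _ (q_ne_zero hN hq)
  calc Kinv hN hq * E hN hq
      = (q ^ 2)⁻¹ • (Kinv hN hq * (q ^ 2 • (E hN hq * K hN hq)) * Kinv hN hq) := by
        rw [mul_smul_comm, smul_mul_assoc, smul_smul, inv_mul_cancel₀ h0, one_smul, mul_assoc,
          mul_assoc (E hN hq), K_mul_Kinv, mul_one]
    _ = _ := by rw [← K_mul_E, ← mul_assoc, Kinv_mul_K, one_mul]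

theorem Kinv_mul_F : Kinv hN hq * F hN hq = q ^ 2 • (F hN hq * Kinv hN hq) := by
  have h0 : q ^ 2 ≠ 0 := pow_ne_zero _ (q_ne_zero hN hq)
  calc Kinv hN hq * F hN hq
      = q ^ 2 • (Kinv hN hq * ((q ^ 2)⁻¹ • (F hN hq * K hN hq)) * Kinv hN hq) := by
        rw [mul_smul_comm, smul_mul_assoc, smul_smul, mul_inv_cancel₀ h0, one_smul, mul_assoc,
          mul_assoc (F hN hq), K_mul_Kinv, mul_one]
    _ = _ := by rw [← K_mul_F, ← mul_assoc, Kinv_mul_K, one_mul]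

/-- The universal property of the presentation. -/
def lift {A : Type*} [Ring A] [Algebra k A] (f : Sl2Gen → A)
    (hE : f Sl2Gen.E ^ N = 0) (hF : f Sl2Gen.F ^ N = 0) (hK : f Sl2Gen.K ^ N = 1)
    (hKE : f Sl2Gen.K * f Sl2Gen.E = q ^ 2 • (f Sl2Gen.E * f Sl2Gen.K))
    (hKF : f Sl2Gen.K * f Sl2Gen.F = (q ^ 2)⁻¹ • (f Sl2Gen.F * f Sl2Gen.K))
    (hEF : f Sl2Gen.E * f Sl2Gen.F - f Sl2Gen.F * f Sl2Gen.E
      = (q - q⁻¹)⁻¹ • (f Sl2Gen.K - f Sl2Gen.K ^ (N - 1))) :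
    SmallQuantumSl2 hN hq →ₐ[k] A :=
  RingQuot.liftAlgHom k (s := Sl2Rel q N) ⟨FreeAlgebra.lift k f, by
    intro x y h
    cases h <;> simpa⟩

theorem lift_gen {A : Type*} [Ring A] [Algebra k A] (f : Sl2Gen → A)
    (hE hF hK hKE hKF hEF) (x : Sl2Gen) :
    lift hN hq f hE hF hK hKE hKF hEF (gen hN hq x) = f x := by
  unfold lift gen mk
  erw [RingQuot.liftAlgHom_mkAlgHom_apply]
  simp

variable {hN hq}

theorem algHom_ext {A : Type*} [Ring A] [Algebra k A] {f g : SmallQuantumSl2 hN hq →ₐ[k] A}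
    (h : ∀ x, f (gen hN hq x) = g (gen hN hq x)) : f = g := by
  refine RingQuot.ringQuot_ext' (S := k) (s := Sl2Rel q N) f g ?_
  refine FreeAlgebra.hom_ext ?_
  funext x
  exact h x

theorem adjoin_gen : Algebra.adjoin k (Set.range (gen hN hq)) = ⊤ := by
  have h := congrArg (Subalgebra.map (mk hN hq)) (FreeAlgebra.adjoin_range_ι (R := k) (X := Sl2Gen))
  rw [AlgHom.map_adjoin, ← Set.range_comp, Algebra.map_top] at h
  exact h.trans ((AlgHom.range_eq_top _).mpr (RingQuot.mkAlgHom_surjective k (Sl2Rel q N)))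

end Algebra

section Hopf

variable {k : Type*} [Field k] {q : k} {N : ℕ} (hN : Odd N) (hq : IsPrimitiveRoot q N)

/-- Values of the comultiplication on generators: `Δ(E) = E ⊗ 1 + K ⊗ E`,
`Δ(F) = F ⊗ K⁻¹ + 1 ⊗ F`, `Δ(K) = K ⊗ K`. -/
def comulGen : Sl2Gen → SmallQuantumSl2 hN hq ⊗[k] SmallQuantumSl2 hN hq
  | Sl2Gen.E => E hN hq ⊗ₜ 1 + K hN hq ⊗ₜ E hN hq
  | Sl2Gen.F => F hN hq ⊗ₜ Kinv hN hq + 1 ⊗ₜ F hN hq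
  | Sl2Gen.K => K hN hq ⊗ₜ K hN hq

theorem isPrimitiveRoot_sq {k : Type*} [Field k] {q : k} {N : ℕ} (hN : Odd N)
    (hq : IsPrimitiveRoot q N) : IsPrimitiveRoot (q ^ 2) N :=
  hq.pow_of_coprime 2 (Nat.coprime_two_left.mpr hN)

/-- The comultiplication as an algebra map. -/
def comulHom : SmallQuantumSl2 hN hq →ₐ[k]
    SmallQuantumSl2 hN hq ⊗[k] SmallQuantumSl2 hN hq :=
  lift hN hq (comulGen hN hq)
    (by
      refine add_pow_eq_zero_of_qCommute hN.pos (isPrimitiveRoot_sq hN hq) ?_ ?_ ?_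
      · simp only [Algebra.TensorProduct.tmul_mul_tmul, K_mul_E, one_mul, mul_one,
          TensorProduct.smul_tmul']
      · rw [Algebra.TensorProduct.tmul_pow, E_pow, TensorProduct.zero_tmul]
      · rw [Algebra.TensorProduct.tmul_pow, E_pow, TensorProduct.tmul_zero])
    (by
      rw [comulGen, add_comm]
      refine add_pow_eq_zero_of_qCommute hN.pos (isPrimitiveRoot_sq hN hq) ?_ ?_ ?_
      · simp only [Algebra.TensorProduct.tmul_mul_tmul, Kinv_mul_F, one_mul, mul_one,
          TensorProduct.tmul_smul]
      · rw [Algebra.TensorProduct.tmul_pow, F_pow, TensorProduct.tmul_zero]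
      · rw [Algebra.TensorProduct.tmul_pow, F_pow, TensorProduct.zero_tmul])
    (by
      rw [comulGen, Algebra.TensorProduct.tmul_pow, K_pow, Algebra.TensorProduct.one_def])
    (by
      simp only [comulGen, mul_add, add_mul, Algebra.TensorProduct.tmul_mul_tmul, K_mul_E, one_mul,
        mul_one, TensorProduct.tmul_smul, TensorProduct.smul_tmul', smul_add])
    (by
      simp only [comulGen, mul_add, add_mul, Algebra.TensorProduct.tmul_mul_tmul, K_mul_F, one_mul,
        mul_one, TensorProduct.tmul_smul, TensorProduct.smul_tmul', smul_add, K_mul_Kinv,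
        Kinv_mul_K])
    (by
      have h0 : q ^ 2 ≠ 0 := pow_ne_zero _ (q_ne_zero hN hq)
      have h1 : E hN hq * F hN hq = F hN hq * E hN hq
          + (q - q⁻¹)⁻¹ • (K hN hq - Kinv hN hq) := by
        rw [← E_mul_F, add_sub_cancel]
      have h2 : (K hN hq ⊗ₜ[k] K hN hq) ^ (N - 1) = Kinv hN hq ⊗ₜ[k] Kinv hN hq :=
        Algebra.TensorProduct.tmul_pow _ _ _
      simp only [comulGen]
      rw [h2]
      simp only [mul_add, add_mul, Algebra.TensorProduct.tmul_mul_tmul, one_mul, mul_one,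
        Kinv_mul_E, K_mul_F, h1, TensorProduct.tmul_smul, TensorProduct.smul_tmul',
        TensorProduct.add_tmul, TensorProduct.tmul_add, TensorProduct.sub_tmul,
        TensorProduct.tmul_sub, smul_sub]
      abel)

/-- The counit as an algebra map: `ε(E) = ε(F) = 0`, `ε(K) = 1`. -/
def counitHom : SmallQuantumSl2 hN hq →ₐ[k] k :=
  lift hN hq (fun x => match x with
      | Sl2Gen.E => 0
      | Sl2Gen.F => 0
      | Sl2Gen.K => 1)
    (by simp [hN.pos.ne']) (by simp [hN.pos.ne']) (by simp) (by simp) (by simp) (by simp)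

theorem comulHom_E : comulHom hN hq (E hN hq) = E hN hq ⊗ₜ 1 + K hN hq ⊗ₜ E hN hq :=
  lift_gen hN hq _ _ _ _ _ _ _ _
theorem comulHom_F : comulHom hN hq (F hN hq) = F hN hq ⊗ₜ Kinv hN hq + 1 ⊗ₜ F hN hq :=
  lift_gen hN hq _ _ _ _ _ _ _ _
theorem comulHom_K : comulHom hN hq (K hN hq) = K hN hq ⊗ₜ K hN hq :=
  lift_gen hN hq _ _ _ _ _ _ _ _
theorem comulHom_Kinv : comulHom hN hq (Kinv hN hq) = Kinv hN hq ⊗ₜ Kinv hN hq := by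
  rw [Kinv, map_pow, comulHom_K, Algebra.TensorProduct.tmul_pow]
theorem counitHom_E : counitHom hN hq (E hN hq) = 0 := lift_gen hN hq _ _ _ _ _ _ _ _
theorem counitHom_F : counitHom hN hq (F hN hq) = 0 := lift_gen hN hq _ _ _ _ _ _ _ _
theorem counitHom_K : counitHom hN hq (K hN hq) = 1 := lift_gen hN hq _ _ _ _ _ _ _ _
theorem counitHom_Kinv : counitHom hN hq (Kinv hN hq) = 1 := by
  rw [Kinv, map_pow, counitHom_K, one_pow]

instance instBialgebra : Bialgebra k (SmallQuantumSl2 hN hq) :=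
  Bialgebra.ofAlgHom (comulHom hN hq) (counitHom hN hq)
    (by
      refine algHom_ext fun x => ?_
      cases x
      · simp [comulHom_E, comulHom_K, TensorProduct.add_tmul, TensorProduct.tmul_add,
          Algebra.TensorProduct.one_def, add_assoc]
      · simp [comulHom_F, comulHom_Kinv, TensorProduct.add_tmul, TensorProduct.tmul_add,
          Algebra.TensorProduct.one_def, add_assoc, -map_pow]
      · simp [comulHom_K])
    (by
      refine algHom_ext fun x => ?_
      cases x
      · simp [comulHom_E, counitHom_E, counitHom_K]
      · simp [comulHom_F, counitHom_F]
      · simp [comulHom_K, counitHom_K])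
    (by
      refine algHom_ext fun x => ?_
      cases x
      · simp [comulHom_E, counitHom_E]
      · simp [comulHom_F, counitHom_F, counitHom_K]
      · simp [comulHom_K, counitHom_K])

theorem comul_eq (x : SmallQuantumSl2 hN hq) :
    Coalgebra.comul (R := k) x = comulHom hN hq x := rfl
theorem counit_eq (x : SmallQuantumSl2 hN hq) :
    Coalgebra.counit (R := k) x = counitHom hN hq x := rfl

/-- Values of the antipode on generators: `S(E) = -K⁻¹E`, `S(F) = -FK`, `S(K) = K⁻¹`. -/
def antipodeGen : Sl2Gen → (SmallQuantumSl2 hN hq)ᵐᵒᵖ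
  | Sl2Gen.E => MulOpposite.op (-(Kinv hN hq * E hN hq))
  | Sl2Gen.F => MulOpposite.op (-(F hN hq * K hN hq))
  | Sl2Gen.K => MulOpposite.op (Kinv hN hq)

theorem neg_mul_pow_eq_zero {k A : Type*} [Field k] [Ring A] [Algebra k A] {c : k} {a b : A}
    (h : b * a = c • (a * b)) {n : ℕ} (ha : a ^ n = 0) : (-(a * b)) ^ n = 0 := by
  have key : ∀ m : ℕ, ∃ d : k, (a * b) ^ m = d • (a ^ m * b ^ m) := by
    intro m
    induction m with
    | zero => exact ⟨1, by simp⟩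
    | succ m ih =>
      obtain ⟨d, hd⟩ := ih
      refine ⟨c ^ m * d, ?_⟩
      rw [pow_succ', hd, mul_smul_comm, ← mul_assoc, mul_assoc a, qCommute_pow h, mul_smul_comm,
        smul_mul_assoc, smul_smul, ← mul_assoc, ← pow_succ', mul_assoc, ← pow_succ', mul_comm d]
  obtain ⟨d, hd⟩ := key n
  rw [neg_pow, hd, ha, zero_mul, smul_zero, mul_zero]

/-- The antipode as an algebra map to the opposite algebra. -/
def antipodeHom : SmallQuantumSl2 hN hq →ₐ[k] (SmallQuantumSl2 hN hq)ᵐᵒᵖ :=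
  lift hN hq (antipodeGen hN hq)
    (by
      apply MulOpposite.unop_injective
      simp only [antipodeGen, MulOpposite.unop_pow, MulOpposite.unop_op, MulOpposite.unop_zero]
      rw [Kinv_mul_E, ← smul_mul_assoc]
      refine neg_mul_pow_eq_zero (c := (q ^ 2)⁻¹) ?_ ?_
      · rw [mul_smul_comm, Kinv_mul_E, smul_mul_assoc]
      · rw [smul_pow, E_pow, smul_zero])
    (by
      apply MulOpposite.unop_injective
      simp only [antipodeGen, MulOpposite.unop_pow, MulOpposite.unop_op, MulOpposite.unop_zero]
      exact neg_mul_pow_eq_zero (K_mul_F hN hq) (F_pow hN hq))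
    (by
      apply MulOpposite.unop_injective
      simp only [antipodeGen, MulOpposite.unop_pow, MulOpposite.unop_op, MulOpposite.unop_one]
      rw [Kinv, ← pow_mul, mul_comm, pow_mul, K_pow, one_pow])
    (by
      have h0 : q ^ 2 ≠ 0 := pow_ne_zero _ (q_ne_zero hN hq)
      apply MulOpposite.unop_injective
      simp only [antipodeGen, MulOpposite.unop_mul, MulOpposite.unop_op, MulOpposite.unop_smul]
      rw [mul_neg, neg_mul, mul_assoc, smul_neg, ← mul_smul_comm, Kinv_mul_E, smul_smul,
        mul_inv_cancel₀ h0, one_smul])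
    (by
      have h0 : q ^ 2 ≠ 0 := pow_ne_zero _ (q_ne_zero hN hq)
      apply MulOpposite.unop_injective
      simp only [antipodeGen, MulOpposite.unop_mul, MulOpposite.unop_op, MulOpposite.unop_smul]
      rw [mul_neg, neg_mul, smul_neg, ← mul_assoc, Kinv_mul_F, smul_mul_assoc, smul_smul,
        inv_mul_cancel₀ h0, one_smul, mul_assoc, mul_assoc, K_mul_Kinv, Kinv_mul_K])
    (by
      have h0 : q ^ 2 ≠ 0 := pow_ne_zero _ (q_ne_zero hN hq)
      apply MulOpposite.unop_injective
      simp only [antipodeGen, MulOpposite.unop_mul, MulOpposite.unop_op, MulOpposite.unop_smul,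
        MulOpposite.unop_sub, MulOpposite.unop_pow, Kinv_pow, neg_mul_neg]
      have h1 : F hN hq * K hN hq * (Kinv hN hq * E hN hq) = F hN hq * E hN hq := by
        rw [mul_assoc, ← mul_assoc (K hN hq), K_mul_Kinv, one_mul]
      have h2 : Kinv hN hq * E hN hq * (F hN hq * K hN hq) = E hN hq * F hN hq := by
        rw [Kinv_mul_E, smul_mul_assoc, mul_assoc, ← mul_assoc (Kinv hN hq), Kinv_mul_F,
          smul_mul_assoc, mul_smul_comm, smul_smul, inv_mul_cancel₀ h0, one_smul, mul_assoc,
          Kinv_mul_K, mul_one]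
      rw [h1, h2, ← neg_sub, E_mul_F, ← smul_neg, neg_sub])

/-- The antipode. -/
def antipodeLin : SmallQuantumSl2 hN hq →ₗ[k] SmallQuantumSl2 hN hq :=
  (MulOpposite.opLinearEquiv k).symm.toLinearMap ∘ₗ (antipodeHom hN hq).toLinearMap

theorem antipodeLin_mul (x y : SmallQuantumSl2 hN hq) :
    antipodeLin hN hq (x * y) = antipodeLin hN hq y * antipodeLin hN hq x := by
  simp [antipodeLin]

theorem antipodeLin_one : antipodeLin hN hq 1 = 1 := by
  simp [antipodeLin]

theorem antipodeLin_E : antipodeLin hN hq (E hN hq) = -(Kinv hN hq * E hN hq) :=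
  congrArg MulOpposite.unop (lift_gen hN hq (antipodeGen hN hq) _ _ _ _ _ _ Sl2Gen.E)
theorem antipodeLin_F : antipodeLin hN hq (F hN hq) = -(F hN hq * K hN hq) :=
  congrArg MulOpposite.unop (lift_gen hN hq (antipodeGen hN hq) _ _ _ _ _ _ Sl2Gen.F)
theorem antipodeLin_K : antipodeLin hN hq (K hN hq) = Kinv hN hq :=
  congrArg MulOpposite.unop (lift_gen hN hq (antipodeGen hN hq) _ _ _ _ _ _ Sl2Gen.K)
theorem antipodeLin_Kinv : antipodeLin hN hq (Kinv hN hq) = K hN hq := by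
  have h : antipodeLin hN hq (Kinv hN hq) * antipodeLin hN hq (K hN hq) = 1 := by
    rw [← antipodeLin_mul, K_mul_Kinv, antipodeLin_one]
  rw [antipodeLin_K] at h
  calc antipodeLin hN hq (Kinv hN hq)
      = antipodeLin hN hq (Kinv hN hq) * (Kinv hN hq * K hN hq) := by rw [Kinv_mul_K, mul_one]
    _ = K hN hq := by rw [← mul_assoc, h, one_mul]

/-- To check the antipode axioms it is enough to look at algebra generators. -/
theorem antipode_axiom_of_gen {A : Type*} [Ring A] [Bialgebra k A] (S : A →ₗ[k] A)
    (h1 : S 1 = 1) (hmul : ∀ x y, S (x * y) = S y * S x) {s : Set A}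
    (hs : Algebra.adjoin k s = ⊤)
    (hl : ∀ x ∈ s, LinearMap.mul' k A (S.rTensor A (Coalgebra.comul x))
      = algebraMap k A (Coalgebra.counit x))
    (hr : ∀ x ∈ s, LinearMap.mul' k A (S.lTensor A (Coalgebra.comul x))
      = algebraMap k A (Coalgebra.counit x)) (x : A) :
    LinearMap.mul' k A (S.rTensor A (Coalgebra.comul x)) = algebraMap k A (Coalgebra.counit x) ∧
    LinearMap.mul' k A (S.lTensor A (Coalgebra.comul x))
      = algebraMap k A (Coalgebra.counit x) := by
  have hL : ∀ (t : A ⊗[k] A) (c : k), LinearMap.mul' k A (S.rTensor A t) = algebraMap k A c →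
      ∀ u : A ⊗[k] A, LinearMap.mul' k A (S.rTensor A (t * u))
        = algebraMap k A c * LinearMap.mul' k A (S.rTensor A u) := by
    intro t c ht u
    have key : ∀ (a b : A) (t : A ⊗[k] A), LinearMap.mul' k A (S.rTensor A (t * (a ⊗ₜ b)))
        = S a * LinearMap.mul' k A (S.rTensor A t) * b := by
      intro a b t
      induction t with
      | zero => simp
      | tmul x y => simp [hmul, mul_assoc]
      | add x y hx hy => rw [add_mul, map_add, map_add, hx, hy, map_add, map_add, mul_add, add_mul]
    induction u with
    | zero => simp
    | tmul a b =>
      rw [key, ht, ← Algebra.commutes]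
      simp [mul_assoc]
    | add x y hx hy => rw [mul_add, map_add, map_add, hx, hy, map_add, map_add, mul_add]
  have hR : ∀ (u : A ⊗[k] A) (c : k), LinearMap.mul' k A (S.lTensor A u) = algebraMap k A c →
      ∀ t : A ⊗[k] A, LinearMap.mul' k A (S.lTensor A (t * u))
        = LinearMap.mul' k A (S.lTensor A t) * algebraMap k A c := by
    intro u c hu t
    have key : ∀ (a b : A) (u : A ⊗[k] A), LinearMap.mul' k A (S.lTensor A ((a ⊗ₜ b) * u))
        = a * LinearMap.mul' k A (S.lTensor A u) * S b := by
      intro a b u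
      induction u with
      | zero => simp
      | tmul x y => simp [hmul, mul_assoc]
      | add x y hx hy => rw [mul_add, map_add, map_add, hx, hy, map_add, map_add, mul_add, add_mul]
    induction t with
    | zero => simp
    | tmul a b =>
      rw [key, hu, mul_assoc, Algebra.commutes]
      simp [mul_assoc]
    | add x y hx hy => rw [add_mul, map_add, map_add, hx, hy, map_add, map_add, add_mul]
  have hx : x ∈ Algebra.adjoin k s := by rw [hs]; trivial
  induction hx using Algebra.adjoin_induction with
  | mem x hx => exact ⟨hl x hx, hr x hx⟩
  | algebraMap r =>
    rw [Bialgebra.comul_algebraMap, Bialgebra.counit_algebraMap, Algebra.algebraMap_eq_smul_one,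
      Algebra.TensorProduct.one_def]
    simp [h1, Algebra.algebraMap_eq_smul_one]
  | add x y _ _ hx hy =>
    simp only [map_add]
    rw [hx.1, hy.1, hx.2, hy.2]
    exact ⟨rfl, rfl⟩
  | mul x y _ _ hx hy =>
    rw [Bialgebra.comul_mul, Bialgebra.counit_mul, map_mul (algebraMap k A)]
    exact ⟨by rw [hL _ _ hx.1, hy.1], by rw [hR _ _ hy.2, hx.2]⟩

theorem antipode_axiom (x : SmallQuantumSl2 hN hq) :
    LinearMap.mul' k _ ((antipodeLin hN hq).rTensor _ (Coalgebra.comul x))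
      = algebraMap k _ (Coalgebra.counit x) ∧
    LinearMap.mul' k _ ((antipodeLin hN hq).lTensor _ (Coalgebra.comul x))
      = algebraMap k _ (Coalgebra.counit x) := by
  refine antipode_axiom_of_gen (antipodeLin hN hq) (antipodeLin_one hN hq)
    (antipodeLin_mul hN hq) (adjoin_gen (hN := hN) (hq := hq)) ?_ ?_ x
  · rintro _ ⟨y, rfl⟩
    rw [comul_eq, counit_eq]
    cases y
    · rw [comulHom_E, counitHom_E]
      simp only [map_add, LinearMap.rTensor_tmul, LinearMap.mul'_apply, antipodeLin_E,
        antipodeLin_K, map_zero, mul_one, neg_add_cancel]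
    · rw [comulHom_F, counitHom_F]
      simp only [map_add, LinearMap.rTensor_tmul, LinearMap.mul'_apply, antipodeLin_F,
        antipodeLin_one, map_zero, one_mul, neg_mul, mul_assoc, K_mul_Kinv, mul_one,
        neg_add_cancel]
    · rw [comulHom_K, counitHom_K]
      simp only [LinearMap.rTensor_tmul, LinearMap.mul'_apply, antipodeLin_K, Kinv_mul_K, map_one]
  · rintro _ ⟨y, rfl⟩
    rw [comul_eq, counit_eq]
    cases y
    · rw [comulHom_E, counitHom_E]
      simp only [map_add, LinearMap.lTensor_tmul, LinearMap.mul'_apply, antipodeLin_E,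
        antipodeLin_one, map_zero, mul_one, mul_neg, ← mul_assoc, K_mul_Kinv, one_mul,
        add_neg_cancel]
    · rw [comulHom_F, counitHom_F]
      simp only [map_add, LinearMap.lTensor_tmul, LinearMap.mul'_apply, antipodeLin_F,
        antipodeLin_Kinv, map_zero, one_mul, add_neg_cancel]
    · rw [comulHom_K, counitHom_K]
      simp only [LinearMap.lTensor_tmul, LinearMap.mul'_apply, antipodeLin_K, K_mul_Kinv, map_one]

instance instHopfAlgebra : HopfAlgebra k (SmallQuantumSl2 hN hq) where
  antipode := antipodeLin hN hq
  mul_antipode_rTensor_comul := LinearMap.ext fun x => (antipode_axiom hN hq x).1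
  mul_antipode_lTensor_comul := LinearMap.ext fun x => (antipode_axiom hN hq x).2

end Hopf

end SmallQuantumSl2

end

/-! The trace. The monomials F^j K^l E^i with exponents below N span u_q because their span is
stable under left multiplication (`span_pbw`). They are independent because the regular
representation can be written down on a space of coordinate functions (`regRep`), where they send
the vector of 1 to distinct coordinate vectors. The coordinate functionals then give Tr(S) as a sum
of diagonal coefficients (`finite_and_trace_of_biorthogonal`). The coefficient at (j, l, i) vanishes
unless 2l = j - i mod N, and then it is (-q)^j (-q⁻¹)^i (`pbwDual_antipode`). Since N is odd, each
pair (j, i) admits exactly one l, so the sum is a product of two geometric sums, 2/(1+q) and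
2/(1+q⁻¹).

The classification. Gauge equivalence does not see Δ itself, so an invariant stable under twisting
is needed. Take a module V with an invariant tensor c in V ⊗ V and an invariant form β. Twisting
replaces c by Fc and β by βF⁻¹. The number β(c) is unchanged because F⁻¹F = 1, and the endomorphism
(id ⊗ β)(c ⊗ -) is unchanged by the cocycle identity (`zigzag_twist`). On a two-dimensional module
with standard basis over u_q, that endomorphism is a scalar s and β(c) = -(q + q⁻¹)s
(`IsStandardBasis.zigzag_eq`).

Every two-dimensional representation with noncommutative image has a standard basis
(`exists_isStandardBasis`). Noncommutativity survives any algebra isomorphism, so the standard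
module of u_p, pulled back to u_q, is again standard. Comparing the two computations gives p + p⁻¹ =
q + q⁻¹, hence p = q or p = q⁻¹. Conversely, E ↦ KF, F ↦ EK⁻¹, K ↦ K is a Hopf isomorphism from
u_{q⁻¹} to u_q (`invHom`), and a Hopf isomorphism is a gauge equivalence with trivial twist. -/

noncomputable section

/-! ### Commuting a power of `E` past `F` -/

/-- Moving `b` leftwards past each factor `a` leaves one term c(g - h) between powers of `a`.
Pulling `g` and `h` to the right collects w^i and w^(-i), which add up to the geometric sums. -/
theorem pow_succ_mul_eq_of_commutator {k A : Type*} [Field k] [Ring A] [Algebra k A]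
    {w c : k} {a b g h : A} (hg : g * a = w • (a * g)) (hh : h * a = w⁻¹ • (a * h))
    (hab : a * b = b * a + c • (g - h)) (n : ℕ) :
    a ^ (n + 1) * b = b * a ^ (n + 1) + c • (a ^ n *
      ((∑ i ∈ Finset.range (n + 1), w ^ i) • g - (∑ i ∈ Finset.range (n + 1), w⁻¹ ^ i) • h)) := by
  induction n with
  | zero => simp [hab]
  | succ n ih =>
    rw [pow_succ' a (n + 1), mul_assoc, ih, mul_add, ← mul_assoc, hab, add_mul, smul_mul_assoc,
      sub_mul, qCommute_pow hg, qCommute_pow hh, mul_smul_comm, ← mul_assoc, ← pow_succ',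
      Finset.sum_range_succ _ (n + 1), Finset.sum_range_succ _ (n + 1), mul_assoc, add_assoc,
      ← smul_add]
    congr 2
    simp only [mul_add, mul_sub, mul_smul_comm, add_smul]
    abel

/-- For a primitive N-th root both geometric sums run over all N-th roots of unity and vanish. -/
theorem commute_pow_of_commutator {k A : Type*} [Field k] [Ring A] [Algebra k A]
    {w c : k} {a b g h : A} {N : ℕ} (hN : 1 < N) (hw : IsPrimitiveRoot w N)
    (hg : g * a = w • (a * g)) (hh : h * a = w⁻¹ • (a * h))
    (hab : a * b = b * a + c • (g - h)) : a ^ N * b = b * a ^ N := by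
  obtain ⟨n, rfl⟩ : ∃ n, N = n + 1 := ⟨N - 1, by omega⟩
  rw [pow_succ_mul_eq_of_commutator hg hh hab, hw.geom_sum_eq_zero hN,
    hw.inv.geom_sum_eq_zero hN]
  simp

namespace SmallQuantumSl2

/-! ### The regular representation in coordinates

The function with value `1` at `(j, l, i)` and `0` elsewhere stands for `F ^ j * K ^ l * E ^ i`. -/

section Regular

variable {k : Type*} [Field k] {q : k} {N : ℕ}

/-- The space of coordinates. -/
abbrev Coord (k : Type*) (N : ℕ) : Type _ := ZMod N → ZMod N → ℕ → k

theorem coordEnd_ext {f g : Module.End k (Coord k N)} (h : ∀ v j l i, f v j l i = g v j l i) :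
    f = g :=
  LinearMap.ext fun v => funext fun j => funext fun l => funext fun i => h v j l i

/-- The action of `F`. -/
def coordF (k : Type*) [Field k] (N : ℕ) : Module.End k (Coord k N) where
  -- The value at j = 0 is 0 rather than f (-1): this imposes F^N = 0 although j is cyclic.
  toFun f j l i := if j = 0 then 0 else f (j - 1) l i
  map_add' f g := by ext j l i; by_cases h : j = 0 <;> simp [h]
  map_smul' c f := by ext j l i; by_cases h : j = 0 <;> simp [h]

theorem coordF_apply (f : Coord k N) (j l : ZMod N) (i : ℕ) :
    coordF k N f j l i = if j = 0 then 0 else f (j - 1) l i := rfl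

variable [NeZero N]

/-- The character `j ↦ q ^ j` of `ZMod N`. -/
def chi (hq : IsPrimitiveRoot q N) : AddChar (ZMod N) k := AddChar.zmodChar N hq.pow_eq_one

theorem chi_one (hq : IsPrimitiveRoot q N) : chi hq 1 = q := by
  have := AddChar.zmodChar_apply' hq.pow_eq_one 1
  rwa [Nat.cast_one, pow_one] at this

theorem chi_eq_sub_one_mul (hq : IsPrimitiveRoot q N) (j : ZMod N) :
    chi hq j = chi hq (j - 1) * q := by
  calc chi hq j = chi hq (j - 1 + 1) := by rw [sub_add_cancel]
    _ = _ := by rw [AddChar.map_add_eq_mul, chi_one]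

theorem chi_ne_zero (hq : IsPrimitiveRoot q N) (j : ZMod N) : chi hq j ≠ 0 := by
  rw [chi, AddChar.zmodChar_apply]
  exact pow_ne_zero _ (hq.ne_zero (NeZero.ne N))

theorem chi_natCast (hq : IsPrimitiveRoot q N) (n : ℕ) : chi hq n = q ^ n :=
  AddChar.zmodChar_apply' hq.pow_eq_one n

/-- The action of `K`. -/
def coordK (hq : IsPrimitiveRoot q N) : Module.End k (Coord k N) where
  -- From K F^j K^(l-1) E^i = q^(-2j) F^j K^l E^i.
  toFun f j l i := ((chi hq j) ^ 2)⁻¹ * f j (l - 1) i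
  map_add' f g := by ext j l i; simp [mul_add]
  map_smul' c f := by ext j l i; simp [mul_left_comm]

/-- The coefficient that measures how far `E` is from commuting with `F ^ j`. -/
def coordCoeff (hq : IsPrimitiveRoot q N) (j : ZMod N) : k :=
  -- This is the q-integer [j] divided by q - q⁻¹. It vanishes at j = 0, so the cyclic index j + 1
  -- in the action of `E` needs no separate case at the wrap-around.
  (chi hq j - (chi hq j)⁻¹) * ((q - q⁻¹)⁻¹) ^ 2

/-- The action of `E`. -/
def coordE (hq : IsPrimitiveRoot q N) : Module.End k (Coord k N) where
  -- The first term comes from F^j E K^l E^(i-1) = q^(-2l) F^j K^l E^i, cut off at N because E^N =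
  -- 0. The second comes from the commutator of E with F^(j+1), which contributes F^j (q^(-j) K -
  -- q^j K⁻¹).
  toFun f j l i := (if 0 < i ∧ i < N then ((chi hq l) ^ 2)⁻¹ * f j l (i - 1) else 0)
    + coordCoeff hq (j + 1) *
      ((chi hq j)⁻¹ * f (j + 1) (l - 1) i - chi hq j * f (j + 1) (l + 1) i)
  map_add' f g := by ext j l i; by_cases h : 0 < i ∧ i < N <;> simp [h] <;> ring
  map_smul' c f := by ext j l i; by_cases h : 0 < i ∧ i < N <;> simp [h] <;> ring

theorem coordK_apply (hq : IsPrimitiveRoot q N) (f : Coord k N) (j l : ZMod N) (i : ℕ) :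
    coordK hq f j l i = ((chi hq j) ^ 2)⁻¹ * f j (l - 1) i := rfl

theorem coordE_apply (hq : IsPrimitiveRoot q N) (f : Coord k N) (j l : ZMod N) (i : ℕ) :
    coordE hq f j l i = (if 0 < i ∧ i < N then ((chi hq l) ^ 2)⁻¹ * f j l (i - 1) else 0)
    + coordCoeff hq (j + 1) *
      ((chi hq j)⁻¹ * f (j + 1) (l - 1) i - chi hq j * f (j + 1) (l + 1) i) := rfl

theorem coordK_pow_apply (hq : IsPrimitiveRoot q N) (n : ℕ) (f : Coord k N) (j l : ZMod N)
    (i : ℕ) : (coordK hq ^ n) f j l i = (((chi hq j) ^ 2)⁻¹) ^ n * f j (l - n) i := by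
  induction n generalizing l with
  | zero => simp
  | succ n ih =>
    rw [pow_succ', Module.End.mul_apply, coordK_apply, ih, pow_succ']
    push_cast
    rw [sub_sub, add_comm (1 : ZMod N)]
    ring

theorem chi_pow_card (hq : IsPrimitiveRoot q N) (j : ZMod N) : (chi hq j) ^ N = 1 := by
  rw [← AddChar.map_nsmul_eq_pow]
  simp

theorem coordK_pow_card (hq : IsPrimitiveRoot q N) : coordK hq ^ N = 1 := by
  refine coordEnd_ext fun f j l i => ?_
  rw [coordK_pow_apply, inv_pow, ← pow_mul, mul_comm 2 N, pow_mul, chi_pow_card]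
  simp

theorem coordK_pow_pred_apply (hq : IsPrimitiveRoot q N) (f : Coord k N) (j l : ZMod N)
    (i : ℕ) : (coordK hq ^ (N - 1)) f j l i = (chi hq j) ^ 2 * f j (l + 1) i := by
  have h0 := chi_ne_zero hq j
  have h : (coordK hq ^ (N - 1)) (coordK hq f) = f := by
    rw [← Module.End.mul_apply, ← pow_succ, Nat.sub_add_cancel (NeZero.one_le), coordK_pow_card]
    rfl
  have h2 := congrFun (congrFun (congrFun
    ((pow_mul_comm' (coordK hq) (N - 1)) ▸ h : (coordK hq * coordK hq ^ (N - 1)) f = f) j)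
      (l + 1)) i
  rw [Module.End.mul_apply, coordK_apply, add_sub_cancel_right] at h2
  rw [← h2]
  field_simp

theorem val_sub_one_of_ne_zero {j : ZMod N} (h : j ≠ 0) : (j - 1).val + 1 = j.val := by
  have h0 : j.val ≠ 0 := fun h' => h ((ZMod.val_eq_zero j).mp h')
  have h1 : ((j.val - 1 : ℕ) : ZMod N) = j - 1 := by
    rw [Nat.cast_sub (by omega), ZMod.natCast_zmod_val, Nat.cast_one]
  rw [← h1, ZMod.val_natCast_of_lt (by have := ZMod.val_lt j; omega)]
  omega

theorem coordF_pow_apply (n : ℕ) (f : Coord k N) (j l : ZMod N) (i : ℕ) :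
    (coordF k N ^ n) f j l i = if j.val < n then 0 else f (j - n) l i := by
  induction n generalizing j with
  | zero => simp
  | succ n ih =>
    rw [pow_succ', Module.End.mul_apply, coordF_apply]
    by_cases h : j = 0
    · simp [h]
    · rw [if_neg h, ih, ← val_sub_one_of_ne_zero h]
      simp only [Nat.add_lt_add_iff_right, Nat.cast_add, Nat.cast_one, sub_sub,
        add_comm (1 : ZMod N)]

theorem coordF_pow_card : coordF k N ^ N = 0 := by
  refine coordEnd_ext fun f j l i => ?_
  simp [coordF_pow_apply, ZMod.val_lt]

theorem coordK_mul_coordF (hq : IsPrimitiveRoot q N) :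
    coordK hq * coordF k N = (q ^ 2)⁻¹ • (coordF k N * coordK hq) := by
  have hq0 := hq.ne_zero (NeZero.ne N)
  refine coordEnd_ext fun f j l i => ?_
  simp only [Module.End.mul_apply, LinearMap.smul_apply, Pi.smul_apply, smul_eq_mul,
    coordF_apply, coordK_apply]
  by_cases h : j = 0
  · simp [h]
  · have h1 := chi_eq_sub_one_mul hq j
    have h0 := chi_ne_zero hq (j - 1)
    rw [if_neg h, if_neg h, h1]
    field_simp

theorem coordK_mul_coordE (hq : IsPrimitiveRoot q N) :
    coordK hq * coordE hq = q ^ 2 • (coordE hq * coordK hq) := by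
  have hq0 := hq.ne_zero (NeZero.ne N)
  refine coordEnd_ext fun f j l i => ?_
  have h1 : chi hq (j + 1) = chi hq j * q := by
    rw [AddChar.map_add_eq_mul, chi_one]
  have h2 := chi_eq_sub_one_mul hq l
  have h0 := chi_ne_zero hq j
  have h0' := chi_ne_zero hq (l - 1)
  simp only [Module.End.mul_apply, LinearMap.smul_apply, Pi.smul_apply, smul_eq_mul,
    coordE_apply, coordK_apply, h1, h2, sub_add_cancel, add_sub_cancel_right]
  by_cases h : 0 < i ∧ i < N
  · simp only [if_pos h]
    field_simp
  · simp only [if_neg h, zero_add]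
    field_simp

theorem coordE_mul_coordF (hq : IsPrimitiveRoot q N) (hd : q - q⁻¹ ≠ 0) :
    coordE hq * coordF k N - coordF k N * coordE hq
      = (q - q⁻¹)⁻¹ • (coordK hq - coordK hq ^ (N - 1)) := by
  have hq0 := hq.ne_zero (NeZero.ne N)
  refine coordEnd_ext fun f j l i => ?_
  simp only [Module.End.mul_apply, LinearMap.smul_apply, LinearMap.sub_apply, Pi.sub_apply,
    Pi.smul_apply, smul_eq_mul, coordK_pow_pred_apply, coordK_apply]
  have h1 : chi hq (j + 1) = chi hq j * q := by
    rw [AddChar.map_add_eq_mul, chi_one]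
  have h2 : chi hq (j - 1) = chi hq j * q⁻¹ := by
    rw [eq_mul_inv_iff_mul_eq₀ hq0, ← chi_eq_sub_one_mul]
  have h0 := chi_ne_zero hq j
  -- At j + 1 = 0, where `coordF` returns 0 instead of a shifted value, the coefficient is also 0;
  -- `e2` treats j = 0 likewise.
  have e1 : coordCoeff hq (j + 1) *
      ((chi hq j)⁻¹ * coordF k N f (j + 1) (l - 1) i - chi hq j * coordF k N f (j + 1) (l + 1) i)
      = coordCoeff hq (j + 1) *
      ((chi hq j)⁻¹ * f j (l - 1) i - chi hq j * f j (l + 1) i) := by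
    by_cases h : j + 1 = 0
    · simp [h, coordCoeff]
    · simp [coordF_apply, h]
  have e2 : coordF k N (coordE hq f) j l i =
      (if 0 < i ∧ i < N then ((chi hq l) ^ 2)⁻¹ * coordF k N f j l (i - 1) else 0)
      + coordCoeff hq j *
      ((chi hq (j - 1))⁻¹ * f j (l - 1) i - chi hq (j - 1) * f j (l + 1) i) := by
    by_cases h : j = 0
    · simp [h, coordCoeff, coordF_apply]
    · simp [coordF_apply, h, coordE_apply]
  rw [coordE_apply, e1, e2, add_sub_add_left_eq_sub]
  have hqq : q * q⁻¹ = 1 := mul_inv_cancel₀ hq0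
  have hjj : chi hq j * (chi hq j)⁻¹ = 1 := mul_inv_cancel₀ h0
  have hdd : (q - q⁻¹) * (q - q⁻¹)⁻¹ = 1 := mul_inv_cancel₀ hd
  simp only [coordCoeff, h1, h2, mul_inv, inv_inv, ← inv_pow (chi hq j)]
  generalize chi hq j = x at *
  generalize x⁻¹ = y at *
  generalize (q - q⁻¹)⁻¹ = d at *
  generalize q⁻¹ = r at *
  generalize f j (l - 1) i = u
  generalize f j (l + 1) i = v
  -- With the powers of q made independent variables this is a polynomial identity; the one relation
  -- needed afterwards is `hdd`.
  have key : (x * q - y * r) * d ^ 2 * (y * u - x * v)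
      - (x - y) * d ^ 2 * (y * q * u - x * r * v) = d * ((q - r) * d) * (y ^ 2 * u - x ^ 2 * v) := by
    ring
  rw [key, hdd, mul_one]

/-- On vectors supported at j = 0 the commutator term is killed by the zero of `coordCoeff`, so E
only raises i. Each application empties the lowest level and everything from N on; the latter
requires 0 < n, since the coordinates with i ≥ N are not zero beforehand. -/
theorem coordE_pow_apply_of_support (hq : IsPrimitiveRoot q N) {f : Coord k N}
    (hf : ∀ j l i, j ≠ 0 → f j l i = 0) (n : ℕ) :
    (∀ j l i, j ≠ 0 → (coordE hq ^ n) f j l i = 0) ∧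
      ∀ j l i, 0 < n → (i < n ∨ N ≤ i) → (coordE hq ^ n) f j l i = 0 := by
  induction n with
  | zero => exact ⟨by simpa using hf, fun j l i h => absurd h (lt_irrefl 0)⟩
  | succ n ih =>
    have hz : ∀ j l i, (coordE hq ^ (n + 1)) f j l i =
        if 0 < i ∧ i < N then ((chi hq l) ^ 2)⁻¹ * (coordE hq ^ n) f j l (i - 1) else 0 := by
      intro j l i
      rw [pow_succ', Module.End.mul_apply, coordE_apply, add_eq_left]
      by_cases h : j + 1 = 0
      · simp [h, coordCoeff]
      · simp [ih.1 _ _ _ h]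
    refine ⟨fun j l i hj => ?_, fun j l i _ hi => ?_⟩
    · rw [hz, ih.1 _ _ _ hj, mul_zero, ite_self]
    · rw [hz]
      split_ifs with h
      · rw [ih.2 _ _ _ (by omega) (by omega), mul_zero]
      · rfl

/-- E^N commutes with F, and every vector is a sum of F^t g_t with g_t supported at j = 0. It is
therefore enough that E^N kills such g_t. -/
theorem coordE_pow_card (hq : IsPrimitiveRoot q N) (hN : 1 < N) (hd : q - q⁻¹ ≠ 0)
    (hq2 : IsPrimitiveRoot (q ^ 2) N) : coordE hq ^ N = 0 := by
  have hq20 : q ^ 2 ≠ 0 := hq2.ne_zero (NeZero.ne N)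
  have hKE := coordK_mul_coordE hq
  have hcomm : Commute (coordE hq ^ N) (coordF k N) := by
    refine commute_pow_of_commutator (c := (q - q⁻¹)⁻¹) (h := coordK hq ^ (N - 1)) hN hq2
      hKE ?_ (sub_eq_iff_eq_add'.mp (coordE_mul_coordF hq hd))
    have h1 : coordK hq * coordK hq ^ (N - 1) = 1 := by
      rw [← pow_succ', Nat.sub_add_cancel NeZero.one_le, coordK_pow_card]
    have h2 : coordK hq ^ (N - 1) * coordK hq = 1 := by
      rw [← pow_succ, Nat.sub_add_cancel NeZero.one_le, coordK_pow_card]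
    calc coordK hq ^ (N - 1) * coordE hq
        = coordK hq ^ (N - 1) * ((q ^ 2)⁻¹ • (coordK hq * coordE hq)) * coordK hq ^ (N - 1) := by
          rw [hKE, smul_smul, inv_mul_cancel₀ hq20, one_smul, mul_assoc, mul_assoc, h1, mul_one]
      _ = _ := by
          rw [mul_smul_comm, ← mul_assoc, h2, one_mul, smul_mul_assoc]
  refine LinearMap.ext fun f => ?_
  -- The slice of f at j = t, moved to j = 0.
  let g : ZMod N → Coord k N := fun t j l i => if j = 0 then f t l i else 0
  have hf : f = ∑ t : ZMod N, (coordF k N ^ t.val) (g t) := by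
    funext j l i
    simp only [Finset.sum_apply, coordF_pow_apply, g, ZMod.natCast_zmod_val]
    rw [Finset.sum_eq_single j]
    · simp
    · intro t _ ht
      simp [sub_eq_zero, ht.symm]
    · simp
  rw [hf, map_sum, LinearMap.zero_apply]
  refine Finset.sum_eq_zero fun t _ => ?_
  have h0 : (coordE hq ^ N) (g t) = 0 := by
    funext j l i
    exact (coordE_pow_apply_of_support hq (fun j l i hj => by simp [g, hj]) N).2 j l i
      (NeZero.pos N) (lt_or_ge i N)
  rw [← Module.End.mul_apply, (hcomm.pow_right t.val).eq, Module.End.mul_apply, h0, map_zero]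

end Regular

end SmallQuantumSl2

/-- Biorthogonality gives independence, so the spanning family is a basis whose coordinates are the
given functionals. No prior knowledge of the dimension is needed. -/
theorem finite_and_trace_of_biorthogonal {k V ι : Type*} [Field k] [AddCommGroup V] [Module k V]
    [Fintype ι] [DecidableEq ι] {b : ι → V} {d : ι → V →ₗ[k] k}
    (hd : ∀ i j, d i (b j) = if i = j then 1 else 0) (hs : ⊤ ≤ Submodule.span k (Set.range b))
    (f : V →ₗ[k] V) : Module.Finite k V ∧ LinearMap.trace k V f = ∑ i, d i (f (b i)) := by
  have hli : LinearIndependent k b := by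
    rw [Fintype.linearIndependent_iff]
    intro g hg i
    have h := congrArg (d i) hg
    simpa [hd] using h
  let B := Module.Basis.mk hli hs
  have hB : ∀ i, B i = b i := fun i => by simp [B]
  have hcoord : ∀ i, B.coord i = d i := by
    intro i
    refine B.ext fun j => ?_
    rw [hB, hd, ← hB, Module.Basis.coord_apply, Module.Basis.repr_self, Finsupp.single_apply]
    simp [eq_comm]
  refine ⟨Module.Finite.of_basis B, ?_⟩
  rw [LinearMap.trace_eq_matrix_trace k B, Matrix.trace]
  refine Finset.sum_congr rfl fun i _ => ?_
  rw [Matrix.diag_apply, LinearMap.toMatrix_apply, hB, ← hcoord, Module.Basis.coord_apply]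

namespace SmallQuantumSl2

theorem sub_inv_ne_zero {k : Type*} [Field k] {q : k} {N : ℕ} (hN : Odd N) (hN1 : 1 < N)
    (hq : IsPrimitiveRoot q N) : q - q⁻¹ ≠ 0 := by
  intro h
  have h0 := q_ne_zero hN hq
  refine (isPrimitiveRoot_sq hN hq).ne_one hN1 ?_
  rw [sub_eq_zero] at h
  rw [pow_two, ← mul_inv_cancel₀ h0, ← h]

/-- For odd N, -1 is not an N-th root of unity. This is how the parity of N enters most of the
divisions below. -/
theorem one_add_ne_zero_of_pow_eq_one {k : Type*} [Field k] (h2 : (2 : k) ≠ 0)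
    {N : ℕ} (hN : Odd N) {x : k} (hx : x ^ N = 1) :
    1 + x ≠ 0 := by
  intro h
  rw [eq_neg_of_add_eq_zero_right h, hN.neg_one_pow] at hx
  exact h2 (by linear_combination -hx)

/-! ### Powers of the generators on coordinate vectors -/

section CoordVectors

variable {k : Type*} [Field k] {q : k} {N : ℕ}

/-- The coordinate vector that stands for `F ^ s * K ^ t * E ^ n`. -/
def coordSingle (k : Type*) [Field k] {N : ℕ} (s t : ZMod N) (n : ℕ) : Coord k N :=
  fun j l i => if j = s ∧ l = t ∧ i = n then 1 else 0

theorem natCast_add_one_ne_zero {n : ℕ} (hn : n + 1 < N) : (n : ZMod N) + 1 ≠ 0 := by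
  intro h
  have h1 : ((n + 1 : ℕ) : ZMod N) = 0 := by exact_mod_cast h
  rw [ZMod.natCast_eq_zero_iff] at h1
  exact absurd (Nat.le_of_dvd (by omega) h1) (by omega)

theorem coordF_coordSingle {s : ZMod N} (hs : s + 1 ≠ 0) (t : ZMod N) (n : ℕ) :
    coordF k N (coordSingle k s t n) = coordSingle k (s + 1) t n := by
  funext j l i
  by_cases hj : j = 0
  · simp [coordF_apply, coordSingle, hj, hs.symm]
  · simp [coordF_apply, coordSingle, hj, sub_eq_iff_eq_add]

theorem coordF_pow_coordSingle {m : ℕ} (hm : m < N) (t : ZMod N) (n : ℕ) :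
    (coordF k N ^ m) (coordSingle k 0 t n) = coordSingle k (m : ZMod N) t n := by
  induction m with
  | zero => simp
  | succ m ih =>
    rw [pow_succ', Module.End.mul_apply, ih (by omega),
      coordF_coordSingle (natCast_add_one_ne_zero hm), Nat.cast_add_one]

variable [NeZero N]

theorem coordK_coordSingle (hq : IsPrimitiveRoot q N) (s t : ZMod N) (n : ℕ) :
    coordK hq (coordSingle k s t n) = ((chi hq s) ^ 2)⁻¹ • coordSingle k s (t + 1) n := by
  funext j l i
  by_cases hj : j = s
  · simp [coordK_apply, coordSingle, hj, sub_eq_iff_eq_add]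
  · simp [coordK_apply, coordSingle, hj]

theorem coordK_pow_coordSingle (hq : IsPrimitiveRoot q N) (s t : ZMod N) (n m : ℕ) :
    (coordK hq ^ m) (coordSingle k s t n)
      = ((chi hq s) ^ (2 * m))⁻¹ • coordSingle k s (t + m) n := by
  induction m with
  | zero => simp
  | succ m ih =>
    rw [pow_succ', Module.End.mul_apply, ih, map_smul, coordK_coordSingle, smul_smul,
      ← mul_inv, ← pow_add, add_assoc, mul_add_one, Nat.cast_add_one]

theorem coordK_pow_pred_coordSingle (hq : IsPrimitiveRoot q N) (s t : ZMod N) (n : ℕ) :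
    (coordK hq ^ (N - 1)) (coordSingle k s t n)
      = (chi hq s) ^ 2 • coordSingle k s (t - 1) n := by
  funext j l i
  by_cases hj : j = s
  · simp [coordK_pow_pred_apply, coordSingle, hj, eq_sub_iff_add_eq]
  · simp [coordK_pow_pred_apply, coordSingle, hj]

theorem coordK_pow_pred_pow_coordSingle (hq : IsPrimitiveRoot q N) (s t : ZMod N) (n m : ℕ) :
    ((coordK hq ^ (N - 1)) ^ m) (coordSingle k s t n)
      = (chi hq s) ^ (2 * m) • coordSingle k s (t - m) n := by
  induction m with
  | zero => simp
  | succ m ih =>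
    rw [pow_succ', Module.End.mul_apply, ih, map_smul, coordK_pow_pred_coordSingle, smul_smul,
      ← pow_add, sub_sub, mul_add_one, Nat.cast_add_one]

theorem coordE_pow_coordSingle (hq : IsPrimitiveRoot q N) {m : ℕ} (hm : m < N) :
    (coordE hq ^ m) (coordSingle k 0 0 0) = coordSingle k 0 0 m := by
  induction m with
  | zero => simp
  | succ m ih =>
    rw [pow_succ', Module.End.mul_apply, ih (by omega)]
    funext j l i
    have h1 : coordCoeff hq (j + 1) * ((chi hq j)⁻¹ * coordSingle k 0 0 m (j + 1) (l - 1) i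
        - chi hq j * coordSingle k 0 0 m (j + 1) (l + 1) i) = 0 := by
      by_cases h : j + 1 = 0
      · simp [h, coordCoeff]
      · simp [coordSingle, h]
    rw [coordE_apply, h1, add_zero]
    by_cases hi : i = m + 1
    · by_cases hl : l = 0
      · simp [hi, hm, hl, coordSingle]
      · simp [hl, coordSingle]
    · have h2 : 0 < i → i - 1 ≠ m := by omega
      by_cases h3 : 0 < i
      · simp [coordSingle, hi, h2 h3]
      · simp [coordSingle, hi, h3]

/-- The m successive actions of K meet F^0, ..., F^(m-1) and give q^(-2(0 + ... + (m-1))). -/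
theorem coordFK_pow_coordSingle (hq : IsPrimitiveRoot q N) {m : ℕ} (hm : m < N) :
    ((coordF k N * coordK hq) ^ m) (coordSingle k 0 0 0)
      = (q ^ (m * (m - 1)))⁻¹ • coordSingle k (m : ZMod N) (m : ZMod N) 0 := by
  induction m with
  | zero => simp
  | succ m ih =>
    rw [pow_succ', Module.End.mul_apply, ih (by omega), Module.End.mul_apply, map_smul,
      coordK_coordSingle, map_smul, map_smul, coordF_coordSingle (natCast_add_one_ne_zero hm),
      smul_smul, ← mul_inv, chi_natCast, ← pow_mul, ← pow_add, Nat.cast_add_one]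
    congr 3
    cases m with
    | zero => rfl
    | succ m =>
      simp only [Nat.add_sub_cancel]
      ring

/-- The commutator part of E does not change i, so level n is reached in n steps only if each step
uses the raising part. The top coefficient is thus a single product, and the lower levels never have
to be computed. -/
theorem coordKE_pow_apply (hq : IsPrimitiveRoot q N) {f : Coord k N}
    (hf : ∀ j l i, 0 < i → f j l i = 0) {n : ℕ} (hn : n < N) :
    (∀ j l i, n < i → ((coordK hq ^ (N - 1) * coordE hq) ^ n) f j l i = 0) ∧
    ∀ j l, ((coordK hq ^ (N - 1) * coordE hq) ^ n) f j l n
      = chi hq j ^ (2 * n) * (chi hq l ^ (2 * n))⁻¹ * (q ^ (n * (n + 1)))⁻¹ * f j (l + n) 0 := by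
  induction n with
  | zero => exact ⟨by simpa using hf, by simp⟩
  | succ n ih =>
    obtain ⟨ih1, ih2⟩ := ih (by omega)
    have hz : ∀ j l i, n < i → ((coordK hq ^ (N - 1) * coordE hq) ^ (n + 1)) f j l i =
        chi hq j ^ 2 * if i < N then ((chi hq (l + 1)) ^ 2)⁻¹ *
          ((coordK hq ^ (N - 1) * coordE hq) ^ n) f j (l + 1) (i - 1) else 0 := by
      intro j l i hi
      rw [pow_succ', Module.End.mul_apply, Module.End.mul_apply, coordK_pow_pred_apply,
        coordE_apply, ih1 _ _ _ hi, ih1 _ _ _ hi]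
      simp [show 0 < i by omega]
    refine ⟨fun j l i hi => ?_, fun j l => ?_⟩
    · rw [hz _ _ _ (by omega), ih1 _ _ _ (by omega), mul_zero, ite_self, mul_zero]
    · have h0 := chi_ne_zero hq l
      have hq0 := hq.ne_zero (NeZero.ne N)
      rw [hz _ _ _ (by omega), if_pos hn, Nat.add_sub_cancel, ih2, AddChar.map_add_eq_mul, chi_one,
        Nat.cast_add_one, add_comm (n : ZMod N), add_assoc]
      field_simp
      ring

end CoordVectors

/-! ### The PBW basis and the trace of the antipode -/

section PBW

variable {k : Type*} [Field k] {q : k} {N : ℕ} (hN : Odd N) (hN1 : 1 < N)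
  (hq : IsPrimitiveRoot q N)

/-- The regular representation on coordinates. -/
def regRep [NeZero N] : SmallQuantumSl2 hN hq →ₐ[k] Module.End k (Coord k N) :=
  lift hN hq (fun x => match x with
      | Sl2Gen.E => coordE hq
      | Sl2Gen.F => coordF k N
      | Sl2Gen.K => coordK hq)
    (coordE_pow_card hq hN1 (sub_inv_ne_zero hN hN1 hq) (isPrimitiveRoot_sq hN hq))
    coordF_pow_card (coordK_pow_card hq) (coordK_mul_coordE hq) (coordK_mul_coordF hq)
    (coordE_mul_coordF hq (sub_inv_ne_zero hN hN1 hq))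

theorem regRep_E [NeZero N] : regRep hN hN1 hq (E hN hq) = coordE hq :=
  lift_gen hN hq _ _ _ _ _ _ _ _
theorem regRep_F [NeZero N] : regRep hN hN1 hq (F hN hq) = coordF k N :=
  lift_gen hN hq _ _ _ _ _ _ _ _
theorem regRep_K [NeZero N] : regRep hN hN1 hq (K hN hq) = coordK hq :=
  lift_gen hN hq _ _ _ _ _ _ _ _

/-- The Poincaré–Birkhoff–Witt monomials. -/
def pbw (j l i : ℕ) : SmallQuantumSl2 hN hq := F hN hq ^ j * K hN hq ^ l * E hN hq ^ i

theorem E_mul_K : E hN hq * K hN hq = (q ^ 2)⁻¹ • (K hN hq * E hN hq) := by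
  rw [K_mul_E, smul_smul, inv_mul_cancel₀ (pow_ne_zero 2 (q_ne_zero hN hq)), one_smul]

/-- The span contains 1, so stability under left multiplication by the generators suffices. Only E
is delicate: it is moved past one F at a time, by induction on j, the commutator being a combination
of K and K⁻¹. Exponents are left unbounded here so that no reduction interferes. -/
theorem span_pbw : Submodule.span k (Set.range fun t : ℕ × ℕ × ℕ => pbw hN hq t.1 t.2.1 t.2.2)
    = ⊤ := by
  set S := Submodule.span k (Set.range fun t : ℕ × ℕ × ℕ => pbw hN hq t.1 t.2.1 t.2.2) with hS
  have hmem : ∀ j l i, pbw hN hq j l i ∈ S := fun j l i => Submodule.subset_span ⟨(j, l, i), rfl⟩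
  have hgen : ∀ a : SmallQuantumSl2 hN hq, (∀ j l i, a * pbw hN hq j l i ∈ S) →
      ∀ y ∈ S, a * y ∈ S := by
    intro a ha y hy
    have h : S ≤ S.comap (LinearMap.mulLeft k a) := by
      rw [hS, Submodule.span_le, ← hS]
      rintro _ ⟨t, rfl⟩
      exact ha _ _ _
    exact h hy
  have hF : ∀ y ∈ S, F hN hq * y ∈ S := by
    refine hgen _ fun j l i => ?_
    rw [pbw, ← mul_assoc, ← mul_assoc, ← pow_succ']
    exact hmem _ _ _
  have hK : ∀ y ∈ S, K hN hq * y ∈ S := by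
    refine hgen _ fun j l i => ?_
    rw [pbw, ← mul_assoc, ← mul_assoc, qCommute_pow (K_mul_F hN hq), smul_mul_assoc,
      smul_mul_assoc, mul_assoc (F hN hq ^ j), ← pow_succ']
    exact S.smul_mem _ (hmem _ _ _)
  have hKn : ∀ (n : ℕ), ∀ y ∈ S, K hN hq ^ n * y ∈ S := by
    intro n y hy
    induction n with
    | zero => simpa using hy
    | succ n ih => rw [pow_succ', mul_assoc]; exact hK _ ih
  have hE : ∀ y ∈ S, E hN hq * y ∈ S := by
    refine hgen _ fun j l i => ?_
    induction j with
    | zero =>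
      rw [pbw, pow_zero, one_mul, ← mul_assoc, qCommute_pow (E_mul_K hN hq), smul_mul_assoc,
        mul_assoc, ← pow_succ']
      refine S.smul_mem _ ?_
      simpa [pbw] using hmem 0 l (i + 1)
    | succ j ih =>
      have h1 : pbw hN hq (j + 1) l i = F hN hq * pbw hN hq j l i := by
        simp only [pbw, pow_succ', mul_assoc]
      have h2 := sub_eq_iff_eq_add'.mp (E_mul_F hN hq)
      rw [h1, ← mul_assoc, h2, add_mul, smul_mul_assoc, sub_mul, mul_assoc]
      exact S.add_mem (hF _ ih) (S.smul_mem _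
        (S.sub_mem (hK _ (hmem _ _ _)) (hKn _ _ (hmem _ _ _))))
  have hall : ∀ x : SmallQuantumSl2 hN hq, ∀ y ∈ S, x * y ∈ S := by
    intro x
    have hx : x ∈ Algebra.adjoin k (Set.range (gen hN hq)) := by rw [adjoin_gen]; trivial
    induction hx using Algebra.adjoin_induction with
    | mem x hx =>
      obtain ⟨g, rfl⟩ := hx
      cases g
      exacts [hE, hF, hK]
    | algebraMap r =>
      intro y hy
      rw [← Algebra.smul_def]
      exact S.smul_mem _ hy
    | add x z _ _ hx hz =>
      intro y hy
      rw [add_mul]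
      exact S.add_mem (hx y hy) (hz y hy)
    | mul x z _ _ hx hz =>
      intro y hy
      rw [mul_assoc]
      exact hx _ (hz y hy)
  refine (Submodule.eq_top_iff').mpr fun x => ?_
  have h1 : (1 : SmallQuantumSl2 hN hq) ∈ S := by simpa [pbw] using hmem 0 0 0
  simpa using hall x 1 h1

theorem antipodeLin_pow (x : SmallQuantumSl2 hN hq) (n : ℕ) :
    antipodeLin hN hq (x ^ n) = antipodeLin hN hq x ^ n := by
  induction n with
  | zero => simp [antipodeLin_one]
  | succ n ih => rw [pow_succ, antipodeLin_mul, ih, pow_succ']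

theorem antipodeLin_pbw (j l i : ℕ) : antipodeLin hN hq (pbw hN hq j l i) = (-1 : k) ^ (j + i) •
    ((Kinv hN hq * E hN hq) ^ i * Kinv hN hq ^ l * (F hN hq * K hN hq) ^ j) := by
  rw [pbw, antipodeLin_mul, antipodeLin_mul, antipodeLin_pow, antipodeLin_pow, antipodeLin_pow,
    antipodeLin_E, antipodeLin_F, antipodeLin_K, ← mul_assoc, ← neg_one_smul k, smul_pow,
    ← neg_one_smul k (F hN hq * K hN hq), smul_pow, mul_smul_comm, smul_mul_assoc, smul_mul_assoc,
    smul_smul, pow_add]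

/-- Since N is odd, (-x)^N = -1 and the telescoped sum has numerator 2. -/
theorem sum_range_neg_pow (hN : Odd N) {x : k} (hx : x ^ N = 1) (hx1 : 1 + x ≠ 0) :
    ∑ i ∈ Finset.range N, (-x) ^ i = 2 / (1 + x) := by
  have h := mul_neg_geom_sum (-x) N
  rw [Odd.neg_pow hN, hx] at h
  rw [eq_div_iff hx1]
  linear_combination h

theorem hopfIndicator_two : hopfIndicator k (SmallQuantumSl2 hN hq) 2
    = LinearMap.trace k _ (antipodeLin hN hq) := by
  simp [hopfIndicator, sweedlerPower]
  rfl

/-- The PBW monomials that form a basis. -/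
def pbwFamily (t : Fin N × ZMod N × Fin N) : SmallQuantumSl2 hN hq :=
  pbw hN hq t.1 t.2.1.val t.2.2

theorem span_pbwFamily : ⊤ ≤ Submodule.span k (Set.range (pbwFamily hN hq)) := by
  rw [← span_pbw hN hq, Submodule.span_le]
  rintro _ ⟨⟨j, l, i⟩, rfl⟩
  by_cases hj : j < N
  · by_cases hi : i < N
    · refine Submodule.subset_span ⟨(⟨j, hj⟩, (l : ZMod N), ⟨i, hi⟩), ?_⟩
      simp only [pbwFamily, pbw, ZMod.val_natCast]
      rw [← pow_eq_pow_mod l (K_pow hN hq)]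
    · have : E hN hq ^ i = 0 := pow_eq_zero_of_le (not_lt.mp hi) (E_pow hN hq)
      simp [pbw, this]
  · have : F hN hq ^ j = 0 := pow_eq_zero_of_le (not_lt.mp hj) (F_pow hN hq)
    simp [pbw, this]

variable [NeZero N]

/-- The coordinate functionals of the PBW basis. -/
def pbwDual (t : Fin N × ZMod N × Fin N) : SmallQuantumSl2 hN hq →ₗ[k] k where
  -- `coordSingle k 0 0 0` stands for 1, so acting on it by x displays the PBW coefficients of x.
  toFun x := regRep hN hN1 hq x (coordSingle k 0 0 0) ((t.1 : ℕ) : ZMod N) t.2.1 t.2.2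
  map_add' x y := by simp
  map_smul' c x := by simp

theorem pbwDual_apply (t : Fin N × ZMod N × Fin N) (x : SmallQuantumSl2 hN hq) :
    pbwDual hN hN1 hq t x
      = regRep hN hN1 hq x (coordSingle k 0 0 0) ((t.1 : ℕ) : ZMod N) t.2.1 t.2.2 := rfl

theorem regRep_pbw {j i : ℕ} (hj : j < N) (hi : i < N) (l : ℕ) :
    regRep hN hN1 hq (pbw hN hq j l i) (coordSingle k 0 0 0)
      = coordSingle k (j : ZMod N) (l : ZMod N) i := by
  rw [pbw, map_mul, map_mul, map_pow, map_pow, map_pow, regRep_E, regRep_F, regRep_K,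
    Module.End.mul_apply, Module.End.mul_apply, coordE_pow_coordSingle hq hi,
    coordK_pow_coordSingle, map_smul, coordF_pow_coordSingle hj]
  simp

theorem pbwDual_pbwFamily (s t : Fin N × ZMod N × Fin N) :
    pbwDual hN hN1 hq s (pbwFamily hN hq t) = if s = t then 1 else 0 := by
  obtain ⟨j, l, i⟩ := s
  obtain ⟨j', l', i'⟩ := t
  have h : ((j : ℕ) : ZMod N) = ((j' : ℕ) : ZMod N) ↔ j = j' := by
    rw [ZMod.natCast_eq_natCast_iff', Nat.mod_eq_of_lt j.2, Nat.mod_eq_of_lt j'.2, Fin.ext_iff]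
  rw [pbwDual_apply, pbwFamily, regRep_pbw hN hN1 hq j'.2 i'.2]
  simp [coordSingle, h, Fin.ext_iff]

/-- Up to sign, S reverses the monomial to (K⁻¹E)^i K^(-l) (FK)^j. Its part with E-exponent i has
F-exponent j and K-exponent j - l - i, so it is diagonal exactly when l = j - l - i. -/
theorem pbwDual_antipode (j l i) : pbwDual hN hN1 hq (j, l, i)
      (antipodeLin hN hq (pbwFamily hN hq (j, l, i)))
    = if 2 * l = (j : ℕ) - (i : ℕ) then (-q) ^ (j : ℕ) * (-q⁻¹) ^ (i : ℕ) else 0 := by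
  have hq0 := q_ne_zero hN hq
  have hsupp : ∀ (c : k) (s t : ZMod N) (j l : ZMod N) (i : ℕ), 0 < i →
      (c • coordSingle k s t 0) j l i = 0 := by
    intro c s t j l i hi
    simp [coordSingle, hi.ne']
  rw [pbwDual_apply, pbwFamily, antipodeLin_pbw]
  simp only [map_smul, map_mul, map_pow, regRep_E, regRep_F, regRep_K, LinearMap.smul_apply,
    Module.End.mul_apply]
  rw [coordFK_pow_coordSingle hq j.2, map_smul, coordK_pow_pred_pow_coordSingle, smul_smul,
    Pi.smul_apply, Pi.smul_apply, Pi.smul_apply, (coordKE_pow_apply hq (hsupp _ _ _) i.2).2,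
    ZMod.natCast_zmod_val]
  simp only [Pi.smul_apply, smul_eq_mul, coordSingle, true_and, and_true]
  have hiff : l + ((i : ℕ) : ZMod N) = (j : ℕ) - l ↔ 2 * l = ((j : ℕ) : ZMod N) - (i : ℕ) := by
    constructor <;> intro h <;> linear_combination h
  simp only [hiff]
  split_ifs with h
  · have h1 : chi hq l ^ 2 = q ^ (j : ℕ) * (q ^ (i : ℕ))⁻¹ := by
      rw [pow_two, ← AddChar.map_add_eq_mul, ← two_mul, h, AddChar.map_sub_eq_div, chi_natCast,
        chi_natCast, div_eq_mul_inv]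
    have h2 : q ^ l.val = chi hq l := (AddChar.zmodChar_apply hq.pow_eq_one l).symm
    have h3 : (q ^ (j : ℕ)) ^ (2 * l.val) = (q ^ (j : ℕ) * (q ^ (i : ℕ))⁻¹) ^ (j : ℕ) := by
      rw [← h1, ← h2]
      simp only [← pow_mul]
      congr 1
      ring
    have h4 : q ^ ((j : ℕ) * ((j : ℕ) - 1)) * q ^ (j : ℕ) = q ^ ((j : ℕ) * (j : ℕ)) := by
      rw [← pow_add]
      congr 1
      cases (j : ℕ) with
      | zero => rfl
      | succ m => simp only [Nat.add_sub_cancel]; ring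
    have h5 : (q ^ ((j : ℕ) * ((j : ℕ) - 1)))⁻¹ = q ^ (j : ℕ) * (q ^ ((j : ℕ) * (j : ℕ)))⁻¹ := by
      rw [← h4]
      field_simp
    rw [pow_mul (chi hq l), h1, chi_natCast, h3, h5, neg_pow q, neg_pow q⁻¹, pow_add]
    simp only [mul_pow, inv_pow, ← pow_mul, mul_inv, inv_inv, mul_add, mul_one, pow_add]
    field_simp
    ring
  · simp

theorem finite_and_trace_antipode (hN1 : 1 < N) (h2 : (2 : k) ≠ 0) :
    Module.Finite k (SmallQuantumSl2 hN hq) ∧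
    LinearMap.trace k _ (antipodeLin hN hq) = 4 / ((1 + q) * (1 + q⁻¹)) := by
  obtain ⟨hfin, htr⟩ := finite_and_trace_of_biorthogonal (pbwDual_pbwFamily hN hN1 hq)
    (span_pbwFamily hN hq) (antipodeLin hN hq)
  refine ⟨hfin, ?_⟩
  -- Invertibility of 2 makes l = (j - i)/2 the unique contributing index for each pair (j, i), so
  -- the triple sum factors.
  have hunit : IsUnit (2 : ZMod N) := by
    have := (ZMod.isUnit_iff_coprime 2 N).mpr (Nat.coprime_two_left.mpr hN)
    exact_mod_cast this
  obtain ⟨u, hu⟩ := hunit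
  have hne := fun x : k => one_add_ne_zero_of_pow_eq_one h2 hN (x := x)
  have hqi : q⁻¹ ^ N = 1 := by rw [inv_pow, hq.pow_eq_one, inv_one]
  rw [htr, Fintype.sum_prod_type]
  simp only [Fintype.sum_prod_type, pbwDual_antipode]
  have hinner : ∀ j : Fin N, ∑ l : ZMod N, ∑ i : Fin N,
      (if 2 * l = ((j : ℕ) : ZMod N) - ((i : ℕ) : ZMod N)
        then (-q) ^ (j : ℕ) * (-q⁻¹) ^ (i : ℕ) else 0)
      = (-q) ^ (j : ℕ) * ∑ i : Fin N, (-q⁻¹) ^ (i : ℕ) := by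
    intro j
    rw [Finset.sum_comm, Finset.mul_sum]
    refine Finset.sum_congr rfl fun i _ => ?_
    rw [Finset.sum_eq_single ((↑u⁻¹ : ZMod N) * (((j : ℕ) : ZMod N) - ((i : ℕ) : ZMod N)))]
    · rw [if_pos]
      rw [← hu, Units.mul_inv_cancel_left]
    · intro l _ hl
      rw [if_neg]
      intro h
      apply hl
      rw [← h, ← hu, Units.inv_mul_cancel_left]
    · simp
  simp only [hinner]
  rw [← Finset.sum_mul, Fin.sum_univ_eq_sum_range (fun i => (-q) ^ i),
    Fin.sum_univ_eq_sum_range (fun i => (-q⁻¹) ^ i),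
    sum_range_neg_pow hN hq.pow_eq_one (hne q hq.pow_eq_one),
    sum_range_neg_pow hN hqi (hne _ hqi), div_mul_div_comm]
  norm_num

end PBW

end SmallQuantumSl2

/-! ### Twisting invariant forms and invariant tensors -/

section Zigzag

variable {k V : Type*} [Field k] [AddCommGroup V] [Module k V]

/-- The endomorphism `(id ⊗ β) (c ⊗ -)` of `V`. -/
def zigzag (β : V ⊗[k] V →ₗ[k] k) (c : V ⊗[k] V) : V →ₗ[k] V :=
  (TensorProduct.rid k V).toLinearMap ∘ₗ β.lTensor V ∘ₗ
    (TensorProduct.assoc k V V V).toLinearMap ∘ₗ TensorProduct.mk k (V ⊗[k] V) V c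

theorem zigzag_apply (β : V ⊗[k] V →ₗ[k] k) (c : V ⊗[k] V) (v : V) : zigzag β c v =
    TensorProduct.rid k V (β.lTensor V (TensorProduct.assoc k V V V (c ⊗ₜ v))) := rfl

theorem zigzag_tmul (β : V ⊗[k] V →ₗ[k] k) (x y v : V) :
    zigzag β (x ⊗ₜ y) v = β (y ⊗ₜ v) • x := by
  simp [zigzag_apply]

theorem zigzag_add (β : V ⊗[k] V →ₗ[k] k) (c d : V ⊗[k] V) (v : V) :
    zigzag β (c + d) v = zigzag β c v + zigzag β d v := by
  simp [zigzag_apply, TensorProduct.add_tmul]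

theorem zigzag_smul (β : V ⊗[k] V →ₗ[k] k) (a : k) (c : V ⊗[k] V) (v : V) :
    zigzag β (a • c) v = a • zigzag β c v := by
  simp [zigzag_apply, ← TensorProduct.smul_tmul']

variable {H : Type*} [Ring H] [HopfAlgebra k H] (ρ : H →ₐ[k] Module.End k V)

/-- The action of `H ⊗ H` on `V ⊗ V`. -/
def tensorRep : H ⊗[k] H →ₐ[k] Module.End k (V ⊗[k] V) :=
  (Module.endTensorEndAlgHom (R := k) (S := k) (A := k)).comp (Algebra.TensorProduct.map ρ ρ)

theorem tensorRep_tmul (a b : H) (v w : V) :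
    tensorRep ρ (a ⊗ₜ b) (v ⊗ₜ w) = ρ a v ⊗ₜ ρ b w := rfl

/-- The action of `H ⊗ (H ⊗ H)` on `V ⊗ (V ⊗ V)`. -/
def tensorRepThree : H ⊗[k] (H ⊗[k] H) →ₐ[k] Module.End k (V ⊗[k] (V ⊗[k] V)) :=
  (Module.endTensorEndAlgHom (R := k) (S := k) (A := k)).comp
    (Algebra.TensorProduct.map ρ (tensorRep ρ))

theorem tensorRepThree_tmul (a : H) (g : H ⊗[k] H) (v : V) (y : V ⊗[k] V) :
    tensorRepThree ρ (a ⊗ₜ g) (v ⊗ₜ y) = ρ a v ⊗ₜ tensorRep ρ g y := rfl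

theorem tensorRepThree_assoc (g : H ⊗[k] H) (h : H) (c : V ⊗[k] V) (v : V) :
    tensorRepThree ρ (Algebra.TensorProduct.assoc k k k H H H (g ⊗ₜ h))
      (TensorProduct.assoc k V V V (c ⊗ₜ v))
    = TensorProduct.assoc k V V V (tensorRep ρ g c ⊗ₜ ρ h v) := by
  induction g with
  | zero => simp
  | add x y hx hy => simp only [TensorProduct.add_tmul, map_add, LinearMap.add_apply, hx, hy]
  | tmul a b =>
    induction c with
    | zero => simp
    | add x y hx hy => simp only [TensorProduct.add_tmul, map_add, hx, hy]
    | tmul x y => rfl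

/-- Invariance of a tensor. -/
def IsInvariantTensor (c : V ⊗[k] V) : Prop :=
  ∀ x : H, tensorRep ρ (Coalgebra.comul (R := k) x) c = Coalgebra.counit (R := k) x • c

/-- Invariance of a bilinear form. -/
def IsInvariantForm (β : V ⊗[k] V →ₗ[k] k) : Prop :=
  ∀ (x : H) (y : V ⊗[k] V),
    β (tensorRep ρ (Coalgebra.comul (R := k) x) y) = Coalgebra.counit (R := k) x * β y

variable {ρ}

/-- The first leg of g meets c only through Δ, where invariance replaces it by its counit; what
remains acts on v. -/
theorem IsInvariantTensor.assoc_apply {c : V ⊗[k] V} (hc : IsInvariantTensor ρ c)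
    (g : H ⊗[k] H) (v : V) :
    tensorRepThree ρ (Algebra.TensorProduct.assoc k k k H H H
      (Algebra.TensorProduct.map (Bialgebra.comulAlgHom k H) (AlgHom.id k H) g))
      (TensorProduct.assoc k V V V (c ⊗ₜ v))
    = TensorProduct.assoc k V V V (c ⊗ₜ ρ (Algebra.TensorProduct.lid k H
    (Algebra.TensorProduct.map (Bialgebra.counitAlgHom k H) (AlgHom.id k H) g)) v) := by
  induction g with
  | zero => simp
  | add x y hx hy =>
    simp only [TensorProduct.tmul_add, map_add, LinearMap.add_apply, hx, hy]
  | tmul a b =>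
    rw [Algebra.TensorProduct.map_tmul, Algebra.TensorProduct.map_tmul, tensorRepThree_assoc,
      Bialgebra.comulAlgHom_apply, hc, Algebra.TensorProduct.lid_tmul, map_smul,
      LinearMap.smul_apply, TensorProduct.smul_tmul]
    rfl

/-- The dual statement: the second leg of g, spread by Δ, is absorbed by β through its counit. -/
theorem IsInvariantForm.lTensor_apply {β : V ⊗[k] V →ₗ[k] k} (hβ : IsInvariantForm ρ β)
    (g : H ⊗[k] H) (y : V ⊗[k] (V ⊗[k] V)) :
    TensorProduct.rid k V (β.lTensor V (tensorRepThree ρ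
      (Algebra.TensorProduct.map (AlgHom.id k H) (Bialgebra.comulAlgHom k H) g) y))
    = ρ (Algebra.TensorProduct.rid k k H
    (Algebra.TensorProduct.map (AlgHom.id k H) (Bialgebra.counitAlgHom k H) g))
      (TensorProduct.rid k V (β.lTensor V y)) := by
  induction g with
  | zero => simp
  | add x y hx hy => simp only [map_add, LinearMap.add_apply, hx, hy]
  | tmul a b =>
    induction y with
    | zero => simp
    | add x y hx hy => simp only [map_add, hx, hy]
    | tmul v y =>
      rw [Algebra.TensorProduct.map_tmul, Algebra.TensorProduct.map_tmul, tensorRepThree_tmul,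
        Bialgebra.comulAlgHom_apply, LinearMap.lTensor_tmul, LinearMap.lTensor_tmul, hβ]
      simp [smul_smul, mul_comm]

/-- A twist does not change the zigzag of an invariant form and an invariant tensor. -/
theorem zigzag_twist {β : V ⊗[k] V →ₗ[k] k} {c : V ⊗[k] V} (hβ : IsInvariantForm ρ β)
    (hc : IsInvariantTensor ρ c) {F : (H ⊗[k] H)ˣ} (hF : IsDrinfeldTwist k F) :
    zigzag (β ∘ₗ tensorRep ρ (↑F⁻¹ : H ⊗[k] H)) (tensorRep ρ (F : H ⊗[k] H) c)
      = zigzag β c := by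
  have hinv : ∀ {B : Type _} [Ring B] [Algebra k B] (φ : H ⊗[k] H →ₐ[k] B),
      φ (F : H ⊗[k] H) * φ (↑F⁻¹ : H ⊗[k] H) = 1 := by
    intro B _ _ φ
    rw [← map_mul, Units.mul_inv, map_one]
  have hinv' : ∀ {B : Type _} [Ring B] [Algebra k B] (φ : H ⊗[k] H →ₐ[k] B),
      φ (↑F⁻¹ : H ⊗[k] H) * φ (F : H ⊗[k] H) = 1 := by
    intro B _ _ φ
    rw [← map_mul, Units.inv_mul, map_one]
  have hl : Algebra.TensorProduct.lid k H (Algebra.TensorProduct.map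
      (Bialgebra.counitAlgHom k H) (AlgHom.id k H) (↑F⁻¹ : H ⊗[k] H)) = 1 := by
    have h := hinv ((Algebra.TensorProduct.lid k H).toAlgHom.comp
      (Algebra.TensorProduct.map (Bialgebra.counitAlgHom k H) (AlgHom.id k H)))
    rw [AlgHom.comp_apply, AlgHom.comp_apply] at h
    have h2 := hF.counit_left
    exact (one_mul _).symm.trans ((congrArg (· * _) h2.symm).trans h)
  -- The cocycle identity rearranged as (1 ⊗ F⁻¹)(F ⊗ 1) = (id ⊗ Δ)(F) (Δ ⊗ id)(F⁻¹). The left side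
  -- is what the twisted zigzag applies; on the right, each factor is absorbed by β or by c and
  -- leaves 1 by the counit conditions.
  have hco : (1 : H) ⊗ₜ[k] (↑F⁻¹ : H ⊗[k] H) * Algebra.TensorProduct.assoc k k k H H H
        ((F : H ⊗[k] H) ⊗ₜ[k] (1 : H))
      = Algebra.TensorProduct.map (AlgHom.id k H) (Bialgebra.comulAlgHom k H) (F : H ⊗[k] H) *
        Algebra.TensorProduct.assoc k k k H H H
        (Algebra.TensorProduct.map (Bialgebra.comulAlgHom k H) (AlgHom.id k H)
          (↑F⁻¹ : H ⊗[k] H)) := by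
    have h1 := hF.cocycle
    have h2 := hinv ((Algebra.TensorProduct.assoc k k k H H H).toAlgHom.comp
      (Algebra.TensorProduct.map (Bialgebra.comulAlgHom k H) (AlgHom.id k H)))
    have h3 := hinv' (Algebra.TensorProduct.includeRight (R := k) (A := H) (B := H ⊗[k] H))
    simp only [AlgHom.comp_apply, Algebra.TensorProduct.includeRight_apply] at h2 h3
    rw [map_mul] at h1
    calc _ = ((1 : H) ⊗ₜ[k] (↑F⁻¹ : H ⊗[k] H) * Algebra.TensorProduct.assoc k k k H H H
        ((F : H ⊗[k] H) ⊗ₜ[k] (1 : H))) * _ := (mul_one _).symm.trans (congrArg _ h2.symm)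
      _ = (1 : H) ⊗ₜ[k] (↑F⁻¹ : H ⊗[k] H) * (Algebra.TensorProduct.assoc k k k H H H
        ((F : H ⊗[k] H) ⊗ₜ[k] (1 : H)) * Algebra.TensorProduct.assoc k k k H H H
        (Algebra.TensorProduct.map (Bialgebra.comulAlgHom k H) (AlgHom.id k H)
          (F : H ⊗[k] H))) * Algebra.TensorProduct.assoc k k k H H H
        (Algebra.TensorProduct.map (Bialgebra.comulAlgHom k H) (AlgHom.id k H)
          (↑F⁻¹ : H ⊗[k] H)) := by simp only [mul_assoc]; rfl
      _ = _ := by rw [h1, ← mul_assoc, h3, one_mul]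
  have h1 : ∀ y, (β ∘ₗ tensorRep ρ (↑F⁻¹ : H ⊗[k] H)).lTensor V y
      = β.lTensor V (tensorRepThree ρ ((1 : H) ⊗ₜ (↑F⁻¹ : H ⊗[k] H)) y) := by
    intro y
    induction y with
    | zero => simp
    | add x y hx hy => simp only [map_add, hx, hy]
    | tmul v y => simp [tensorRepThree_tmul]
  refine LinearMap.ext fun v => ?_
  have h2 := tensorRepThree_assoc ρ (F : H ⊗[k] H) 1 c v
  rw [map_one, Module.End.one_apply] at h2
  rw [zigzag_apply, ← h2, h1, ← Module.End.mul_apply, ← map_mul, hco, map_mul,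
    Module.End.mul_apply, hc.assoc_apply, hl, hβ.lTensor_apply, hF.counit_right, map_one,
    Module.End.one_apply, Module.End.one_apply, zigzag_apply]

end Zigzag

namespace SmallQuantumSl2

/-! ### Two-dimensional modules -/

section TwoDimensional

variable {k : Type*} [Field k] {q : k} {N : ℕ} {hN : Odd N} {hq : IsPrimitiveRoot q N}
  {V : Type*} [AddCommGroup V] [Module k V]

/-- A basis of a two-dimensional module in which the generators act by the standard matrices. -/
structure IsStandardBasis (ρ : SmallQuantumSl2 hN hq →ₐ[k] Module.End k V)
    (b : Module.Basis (Fin 2) k V) : Prop where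
  E_zero : ρ (E hN hq) (b 0) = 0
  E_one : ρ (E hN hq) (b 1) = b 0
  K_zero : ρ (K hN hq) (b 0) = q • b 0
  K_one : ρ (K hN hq) (b 1) = q⁻¹ • b 1

/-- Invariance under K kills the components on b₀ ⊗ b₀ and b₁ ⊗ b₁, whose weights q² and q⁻² differ
from 1. Invariance under E fixes the ratio of the other two to -q, for c and for β alike. Hence both
numbers are multiples of c₀₁ β(b₀ ⊗ b₁): β(c) with factor 1 + q², the zigzag with factor -q. The
action of F is not needed. -/
theorem IsStandardBasis.zigzag_eq {ρ : SmallQuantumSl2 hN hq →ₐ[k] Module.End k V}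
    {b : Module.Basis (Fin 2) k V} (hb : IsStandardBasis ρ b) (hq4 : q ^ 2 ≠ 1)
    {c : V ⊗[k] V} {β : V ⊗[k] V →ₗ[k] k} (hc : IsInvariantTensor ρ c)
    (hβ : IsInvariantForm ρ β) :
    ∃ s : k, β c = -(q + q⁻¹) * s ∧ ∀ v, zigzag β c v = s • v := by
  have hq0 := q_ne_zero hN hq
  have hinv : q⁻¹ * q⁻¹ ≠ 1 := by
    intro h
    apply hq4
    rw [← mul_inv, inv_eq_one, ← pow_two] at h
    exact h
  have hE0 := hb.E_zero
  have hE1 := hb.E_one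
  have hK0 := hb.K_zero
  have hK1 := hb.K_one
  obtain ⟨c00, c01, c10, c11, rfl⟩ : ∃ c00 c01 c10 c11 : k, c = c00 • (b 0 ⊗ₜ b 0)
      + c01 • (b 0 ⊗ₜ b 1) + c10 • (b 1 ⊗ₜ b 0) + c11 • (b 1 ⊗ₜ b 1) := by
    refine ⟨(b.tensorProduct b).repr c (0, 0), (b.tensorProduct b).repr c (0, 1),
      (b.tensorProduct b).repr c (1, 0), (b.tensorProduct b).repr c (1, 1), ?_⟩
    refine ((b.tensorProduct b).sum_repr c).symm.trans ?_
    rw [Fintype.sum_prod_type]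
    simp only [Fin.sum_univ_two, Module.Basis.tensorProduct_apply, add_assoc]
  have hcK := hc (K hN hq)
  have hcE := hc (E hN hq)
  rw [comul_eq, counit_eq, comulHom_K, counitHom_K] at hcK
  rw [comul_eq, counit_eq, comulHom_E, counitHom_E] at hcE
  simp only [map_add, map_smul, LinearMap.add_apply, tensorRep_tmul, hE0, hE1, hK0, hK1, map_one,
    Module.End.one_apply, TensorProduct.zero_tmul, TensorProduct.tmul_zero, zero_add, add_zero,
    smul_zero, zero_smul, one_smul, TensorProduct.smul_tmul', TensorProduct.tmul_smul,
    smul_smul] at hcK hcE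
  have r : ∀ i j s t, (b.tensorProduct b).repr (b i ⊗ₜ b j) (s, t)
      = if i = s ∧ j = t then 1 else 0 := by
    intro i j s t
    rw [← Module.Basis.tensorProduct_apply, Module.Basis.repr_self, Finsupp.single_apply]
    simp
  have e00 := congrArg (fun x => (b.tensorProduct b).repr x (0, 0)) hcK
  have e11 := congrArg (fun x => (b.tensorProduct b).repr x (1, 1)) hcK
  have e01 := congrArg (fun x => (b.tensorProduct b).repr x (0, 0)) hcE
  simp [r, ← TensorProduct.smul_tmul'] at e00 e11 e01
  have b00 := hβ (K hN hq) (b 0 ⊗ₜ b 0)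
  have b11 := hβ (K hN hq) (b 1 ⊗ₜ b 1)
  have b01 := hβ (E hN hq) (b 1 ⊗ₜ b 1)
  rw [comul_eq, counit_eq, comulHom_K, counitHom_K] at b00 b11
  rw [comul_eq, counit_eq, comulHom_E, counitHom_E] at b01
  simp [tensorRep_tmul, hE1, hK0, hK1, ← TensorProduct.smul_tmul'] at b00 b11 b01
  have hz : ∀ {x y : k}, x ≠ 1 → x * y = y → y = 0 := by
    intro x y hx h
    have h2 : (x - 1) * y = 0 := by linear_combination h
    exact (mul_eq_zero.mp h2).resolve_left (sub_ne_zero.mpr hx)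
  rw [← mul_assoc, ← pow_two] at b00
  rw [← mul_assoc] at b11
  have d00 : c00 = 0 := hz hq4 (by linear_combination e00)
  have d11 : c11 = 0 := hz hinv (by linear_combination e11)
  have d10 : c10 = -q * c01 := by linear_combination e01
  have f10 : β (b 1 ⊗ₜ b 0) = -q * β (b 0 ⊗ₜ b 1) := by
    field_simp at b01
    linear_combination b01
  have f00 := hz hq4 b00
  have f11 := hz hinv b11
  subst d00 d11 d10
  refine ⟨-q * c01 * β (b 0 ⊗ₜ b 1), ?_, ?_⟩
  · simp only [map_add, map_smul, f10, smul_eq_mul]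
    field_simp
    ring
  · intro v
    suffices h : zigzag β (((0 : k) • (b 0 ⊗ₜ b 0)) + c01 • (b 0 ⊗ₜ b 1)
        + (-q * c01) • (b 1 ⊗ₜ b 0) + (0 : k) • (b 1 ⊗ₜ b 1))
        = (-q * c01 * β (b 0 ⊗ₜ b 1)) • LinearMap.id from congrArg (fun f => f v) h
    refine b.ext fun i => ?_
    fin_cases i
    · simp only [Fin.zero_eta, zigzag_add, zigzag_smul, zigzag_tmul, f00, f10,
        LinearMap.smul_apply, LinearMap.id_apply]
      module
    · simp only [Fin.mk_one, zigzag_add, zigzag_smul, zigzag_tmul, f11,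
        LinearMap.smul_apply, LinearMap.id_apply]
      module

/-- If E acts by 0, the commutator relation gives K = K⁻¹, so K² = 1, and K = 1 because N is odd.
Then KF = q⁻²FK forces F = 0. -/
theorem eq_algebraMap_counit_of_E_eq_zero (hN1 : 1 < N) {A : Type*} [Ring A] [Algebra k A]
    (ρ : SmallQuantumSl2 hN hq →ₐ[k] A) (hE : ρ (E hN hq) = 0) (x : SmallQuantumSl2 hN hq) :
    ρ x = algebraMap k A (counitHom hN hq x) := by
  have hd := sub_inv_ne_zero hN hN1 hq
  have h1 := congrArg ρ (E_mul_F hN hq)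
  rw [map_sub, map_mul, map_mul, hE, zero_mul, mul_zero, sub_zero, map_smul, map_sub] at h1
  have h2 : ρ (K hN hq) = ρ (Kinv hN hq) :=
    sub_eq_zero.mp ((smul_eq_zero_iff_right (inv_ne_zero hd)).mp h1.symm)
  have hK2 : ρ (K hN hq) ^ 2 = 1 := by
    rw [pow_two]
    nth_rw 1 [h2]
    rw [← map_mul, Kinv_mul_K, map_one]
  have hK : ρ (K hN hq) = 1 := by
    obtain ⟨m, hm⟩ := id hN
    have h3 : ρ (K hN hq) ^ N = 1 := by rw [← map_pow, K_pow, map_one]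
    have h4 : ρ (K hN hq) ^ N = ρ (K hN hq) ^ (2 * m + 1) := congrArg _ hm
    rw [← h3, h4, pow_succ, pow_mul, hK2, one_pow, one_mul]
  have hF : ρ (F hN hq) = 0 := by
    have h4 := congrArg ρ (K_mul_F hN hq)
    rw [map_mul, hK, one_mul, map_smul, map_mul, hK, mul_one] at h4
    have h5 : (1 - (q ^ 2)⁻¹) • ρ (F hN hq) = 0 := by rw [sub_smul, one_smul, ← h4, sub_self]
    refine (smul_eq_zero_iff_right ?_).mp h5
    intro h6
    rw [sub_eq_zero, eq_comm, inv_eq_one] at h6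
    exact (isPrimitiveRoot_sq hN hq).ne_one hN1 h6
  have h : ρ = (Algebra.ofId k A).comp (counitHom hN hq) := by
    refine algHom_ext fun y => ?_
    cases y
    · rw [hE, AlgHom.comp_apply, counitHom_E, map_zero]
    · rw [hF, AlgHom.comp_apply, counitHom_F, map_zero]
    · rw [hK, AlgHom.comp_apply, counitHom_K, map_one]
  rw [h]
  rfl

theorem pow_pred_eq_inv {k : Type*} [Field k] {x : k} {N : ℕ} (hN : 0 < N) (hx : x ^ N = 1) :
    x ^ (N - 1) = x⁻¹ := by
  refine eq_inv_of_mul_eq_one_left ?_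
  rw [← pow_succ, Nat.sub_add_cancel hN, hx]

/-- Noncommutativity rules out E = 0, and nilpotency in dimension 2 gives E² = 0. For Ew ≠ 0, the
vectors Ew and a corrected w are eigenvectors of K with eigenvalues q²d and d. The commutator of E
and F has trace 0, so K and K⁻¹ have equal traces; this forces d = q⁻¹. -/
theorem exists_isStandardBasis [CharZero k] (hN1 : 1 < N) (hV : Module.finrank k V = 2)
    (ρ : SmallQuantumSl2 hN hq →ₐ[k] Module.End k V) (hρ : ∃ x y, ρ x * ρ y ≠ ρ y * ρ x) :
    ∃ b : Module.Basis (Fin 2) k V, IsStandardBasis ρ b := by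
  have hq0 := q_ne_zero hN hq
  have hq2 : q ^ 2 ≠ 1 := (isPrimitiveRoot_sq hN hq).ne_one hN1
  have : Module.Finite k V := Module.finite_of_finrank_pos (by omega)
  have hE : ρ (E hN hq) ≠ 0 := by
    intro h
    obtain ⟨x, y, hxy⟩ := hρ
    apply hxy
    simp only [eq_algebraMap_counit_of_E_eq_zero hN1 ρ h]
    exact Algebra.commutes _ _
  obtain ⟨w, hw⟩ : ∃ w, ρ (E hN hq) w ≠ 0 := by
    by_contra! h
    exact hE (LinearMap.ext h)
  -- Kernels of powers of an endomorphism are stationary from the dimension on, so the kernels of E²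
  -- and E^N agree.
  have hEE : ∀ v, ρ (E hN hq) (ρ (E hN hq) v) = 0 := by
    have h1 := Module.End.ker_pow_eq_ker_pow_finrank_of_le (f := ρ (E hN hq)) (m := N)
      (by omega)
    rw [hV, ← map_pow, E_pow, map_zero, LinearMap.ker_zero] at h1
    intro v
    have h2 : v ∈ LinearMap.ker (ρ (E hN hq) ^ 2) := h1 ▸ Submodule.mem_top
    simpa [pow_two] using h2
  have hKE : ∀ v, ρ (K hN hq) (ρ (E hN hq) v) = q ^ 2 • ρ (E hN hq) (ρ (K hN hq) v) := by
    intro v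
    have h := congrArg (fun f => ρ f v) (K_mul_E hN hq)
    simpa using h
  have hpair : ∀ s : k, LinearIndependent k ![ρ (E hN hq) w, w + s • ρ (E hN hq) w] := by
    intro s
    rw [LinearIndependent.pair_iff]
    intro x y hxy
    have h := congrArg (ρ (E hN hq)) hxy
    simp only [map_add, map_smul, hEE, smul_zero, add_zero, zero_add, map_zero] at h
    have hy : y = 0 := (smul_eq_zero_iff_left hw).mp h
    rw [hy, zero_smul, add_zero] at hxy
    exact ⟨(smul_eq_zero_iff_left hw).mp hxy, hy⟩
  let B : k → Module.Basis (Fin 2) k V := fun s =>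
    basisOfLinearIndependentOfCardEqFinrank (hpair s) (by simp [hV])
  have hB0 : ∀ s, B s 0 = ρ (E hN hq) w := fun s => by simp [B]
  have hB1 : ∀ s, B s 1 = w + s • ρ (E hN hq) w := fun s => by simp [B]
  have hexp : ∀ v, ∃ x y : k, v = x • ρ (E hN hq) w + y • w := by
    intro v
    refine ⟨(B 0).repr v 0, (B 0).repr v 1, ?_⟩
    have h := (B 0).sum_repr v
    rw [Fin.sum_univ_two, hB0, hB1, zero_smul, add_zero] at h
    exact h.symm
  obtain ⟨t, d, ht⟩ := hexp (ρ (K hN hq) w)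
  have hK0 : ρ (K hN hq) (ρ (E hN hq) w) = (q ^ 2 * d) • ρ (E hN hq) w := by
    rw [hKE, ht, map_add, map_smul, map_smul, hEE, smul_zero, zero_add, smul_smul]
  have hKN : ρ (K hN hq) ^ N = 1 := by rw [← map_pow, K_pow, map_one]
  have hpow : ∀ (v : V) (x : k), ρ (K hN hq) v = x • v → ∀ n : ℕ,
      (ρ (K hN hq) ^ n) v = x ^ n • v := by
    intro v x hv n
    induction n with
    | zero => simp
    | succ n ih => rw [pow_succ', Module.End.mul_apply, ih, map_smul, hv, smul_smul, pow_succ]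
  have hdN : d ^ N = 1 := by
    have h := hpow _ _ hK0 N
    rw [hKN, Module.End.one_apply, mul_pow, ← pow_mul, mul_comm 2 N, pow_mul, hq.pow_eq_one,
      one_pow, one_mul] at h
    have h2 : (d ^ N - 1) • ρ (E hN hq) w = 0 := by rw [sub_smul, one_smul, ← h, sub_self]
    exact sub_eq_zero.mp ((smul_eq_zero_iff_left hw).mp h2)
  have hd0 : d ≠ 0 := by
    rintro rfl
    rw [zero_pow (by omega)] at hdN
    exact zero_ne_one hdN
  have hne : d - q ^ 2 * d ≠ 0 := by
    intro h
    have h2 : d * (q ^ 2 - 1) = 0 := by linear_combination -h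
    exact (mul_ne_zero hd0 (sub_ne_zero.mpr hq2)) h2
  -- With Kw = t·Ew + d·w, the vector w + s·Ew is an eigenvector for d exactly when t + s·q²d = s·d.
  set s := t / (d - q ^ 2 * d) with hs
  have hst : t = s * (d - q ^ 2 * d) := by rw [hs, div_mul_cancel₀ _ hne]
  have hK1 : ρ (K hN hq) (w + s • ρ (E hN hq) w) = d • (w + s • ρ (E hN hq) w) := by
    rw [map_add, map_smul, ht, hK0, hst]
    module
  have htr : LinearMap.trace k V (ρ (K hN hq)) = LinearMap.trace k V (ρ (Kinv hN hq)) := by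
    have h1 := congrArg (fun x => LinearMap.trace k V (ρ x)) (E_mul_F hN hq)
    simp only [map_sub, map_mul, map_smul] at h1
    rw [LinearMap.trace_mul_comm, sub_self, eq_comm] at h1
    exact sub_eq_zero.mp ((smul_eq_zero_iff_right
      (inv_ne_zero (sub_inv_ne_zero hN hN1 hq))).mp h1)
  have htrace : ∀ (f : Module.End k V) (x y : k), f (B s 0) = x • B s 0 → f (B s 1) = y • B s 1 →
      LinearMap.trace k V f = x + y := by
    intro f x y h0 h1
    rw [LinearMap.trace_eq_matrix_trace k (B s), Matrix.trace, Fin.sum_univ_two]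
    simp [LinearMap.toMatrix_apply, h0, h1]
  have hd2 : (q ^ 2 * d) ^ N = 1 := by
    rw [mul_pow, hdN, ← pow_mul, mul_comm 2 N, pow_mul, hq.pow_eq_one, one_pow, one_mul]
  rw [← hB0 s] at hK0
  rw [← hB1 s] at hK1
  rw [htrace _ _ _ hK0 hK1, map_pow, htrace _ _ _ (hpow _ _ hK0 _) (hpow _ _ hK1 _),
    pow_pred_eq_inv hN.pos hd2, pow_pred_eq_inv hN.pos hdN] at htr
  have hodd := fun x : k => one_add_ne_zero_of_pow_eq_one two_ne_zero hN (x := x)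
  have hq2N : (q ^ 2) ^ N = 1 := (isPrimitiveRoot_sq hN hq).pow_eq_one
  -- The trace equality reads (1 + q²)d = (1 + q²)/(q²d), and 1 + q² ≠ 0. The sign is settled next:
  -- qd is an N-th root of unity, so it is not -1.
  have hqd2 : (q * d) ^ 2 = 1 := by
    have h1 : (1 + q ^ 2) * ((q * d) ^ 2 - 1) = 0 := by
      field_simp at htr
      linear_combination htr
    exact sub_eq_zero.mp ((mul_eq_zero.mp h1).resolve_left (hodd _ hq2N))
  have hqd : q * d = 1 := by
    have h1 : (1 + q * d) * (q * d - 1) = 0 := by linear_combination hqd2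
    refine sub_eq_zero.mp ((mul_eq_zero.mp h1).resolve_left (hodd _ ?_))
    rw [mul_pow, hq.pow_eq_one, hdN, one_mul]
  have hd : d = q⁻¹ := eq_inv_of_mul_eq_one_right hqd
  refine ⟨B s, ⟨?_, ?_, ?_, ?_⟩⟩
  · rw [hB0, hEE]
  · rw [hB0, hB1, map_add, map_smul, hEE, smul_zero, add_zero]
  · rw [hK0]
    congr 1
    rw [pow_two, mul_assoc, hqd, mul_one]
  · rw [hK1, hd]

/-! ### The standard module, its invariant tensor and its invariant form -/

variable (hN hq)

/-- The standard basis of the standard module. -/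
abbrev stdBasis (k : Type*) [Field k] : Module.Basis (Fin 2) k (Fin 2 → k) := Pi.basisFun k (Fin 2)

/-- The action of `E` on the standard module. -/
def stdE (k : Type*) [Field k] : Module.End k (Fin 2 → k) :=
  (stdBasis k).constr k ![0, stdBasis k 0]
/-- The action of `F` on the standard module. -/
def stdF (k : Type*) [Field k] : Module.End k (Fin 2 → k) :=
  (stdBasis k).constr k ![stdBasis k 1, 0]
/-- The action of `K` on the standard module. -/
def stdK (q : k) : Module.End k (Fin 2 → k) :=
  (stdBasis k).constr k ![q • stdBasis k 0, q⁻¹ • stdBasis k 1]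

theorem stdE_zero : stdE k (stdBasis k 0) = 0 := by rw [stdE, Module.Basis.constr_basis]; rfl
theorem stdE_one : stdE k (stdBasis k 1) = stdBasis k 0 := by
  rw [stdE, Module.Basis.constr_basis]; rfl
theorem stdF_zero : stdF k (stdBasis k 0) = stdBasis k 1 := by
  rw [stdF, Module.Basis.constr_basis]; rfl
theorem stdF_one : stdF k (stdBasis k 1) = 0 := by rw [stdF, Module.Basis.constr_basis]; rfl

theorem stdK_pow_zero (n : ℕ) : (stdK q ^ n) (stdBasis k 0) = q ^ n • stdBasis k 0 := by
  have h : stdK q (stdBasis k 0) = q • stdBasis k 0 := by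
    rw [stdK, Module.Basis.constr_basis]; rfl
  induction n with
  | zero => rw [pow_zero, pow_zero, one_smul, Module.End.one_apply]
  | succ n ih => rw [pow_succ', Module.End.mul_apply, ih, map_smul, h, smul_smul, pow_succ]

theorem stdK_pow_one (n : ℕ) : (stdK q ^ n) (stdBasis k 1) = q⁻¹ ^ n • stdBasis k 1 := by
  have h : stdK q (stdBasis k 1) = q⁻¹ • stdBasis k 1 := by
    rw [stdK, Module.Basis.constr_basis]; rfl
  induction n with
  | zero => rw [pow_zero, pow_zero, one_smul, Module.End.one_apply]
  | succ n ih => rw [pow_succ', Module.End.mul_apply, ih, map_smul, h, smul_smul, pow_succ]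

theorem stdK_zero : stdK q (stdBasis k 0) = q • stdBasis k 0 := by
  simpa only [pow_one] using stdK_pow_zero (q := q) 1
theorem stdK_one : stdK q (stdBasis k 1) = q⁻¹ • stdBasis k 1 := by
  simpa only [pow_one] using stdK_pow_one (q := q) 1

theorem stdK_pow_pred_zero (hN : Odd N) (hq : IsPrimitiveRoot q N) :
    (stdK q ^ (N - 1)) (stdBasis k 0) = q⁻¹ • stdBasis k 0 := by
  rw [stdK_pow_zero, pow_pred_eq_inv hN.pos hq.pow_eq_one]
theorem stdK_pow_pred_one (hN : Odd N) (hq : IsPrimitiveRoot q N) :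
    (stdK q ^ (N - 1)) (stdBasis k 1) = q • stdBasis k 1 := by
  rw [stdK_pow_one, pow_pred_eq_inv hN.pos hq.inv.pow_eq_one, inv_inv]

/-- The standard two-dimensional representation. -/
def stdRep (hN1 : 1 < N) : SmallQuantumSl2 hN hq →ₐ[k] Module.End k (Fin 2 → k) :=
  lift hN hq (fun x => match x with
      | Sl2Gen.E => stdE k
      | Sl2Gen.F => stdF k
      | Sl2Gen.K => stdK q)
    (pow_eq_zero_of_le hN1 <| (stdBasis k).ext fun i => by
      rw [pow_two, Module.End.mul_apply]
      fin_cases i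
      · exact (congrArg _ stdE_zero).trans (map_zero _)
      · exact (congrArg _ stdE_one).trans stdE_zero)
    (pow_eq_zero_of_le hN1 <| (stdBasis k).ext fun i => by
      rw [pow_two, Module.End.mul_apply]
      fin_cases i
      · exact (congrArg _ stdF_zero).trans stdF_one
      · exact (congrArg _ stdF_one).trans (map_zero _))
    ((stdBasis k).ext fun i => by
      fin_cases i
      · refine (stdK_pow_zero N).trans ?_
        rw [hq.pow_eq_one, one_smul]
        rfl
      · refine (stdK_pow_one N).trans ?_
        rw [hq.inv.pow_eq_one, one_smul]
        rfl)
    ((stdBasis k).ext fun i => by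
      have h0 := q_ne_zero hN hq
      match i with
      | 0 => simp only [Module.End.mul_apply, LinearMap.smul_apply, stdE_zero, stdK_zero, map_smul,
          map_zero, smul_zero]
      | 1 =>
        simp only [Module.End.mul_apply, LinearMap.smul_apply, stdE_one, stdK_zero, stdK_one,
          map_smul, smul_smul]
        congr 1
        field_simp)
    ((stdBasis k).ext fun i => by
      have h0 := q_ne_zero hN hq
      match i with
      | 1 => simp only [Module.End.mul_apply, LinearMap.smul_apply, stdF_one, stdK_one, map_smul,
          map_zero, smul_zero]
      | 0 =>
        simp only [Module.End.mul_apply, LinearMap.smul_apply, stdF_zero, stdK_zero, stdK_one,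
          map_smul, smul_smul]
        congr 1
        field_simp)
    ((stdBasis k).ext fun i => by
      have hd := sub_inv_ne_zero hN hN1 hq
      match i with
      | 0 =>
        simp only [Module.End.mul_apply, LinearMap.smul_apply, LinearMap.sub_apply, stdF_zero,
          stdE_one, stdE_zero, map_zero, sub_zero, stdK_zero, stdK_pow_pred_zero hN hq]
        rw [← sub_smul, smul_smul, inv_mul_cancel₀ hd, one_smul]
      | 1 =>
        simp only [Module.End.mul_apply, LinearMap.smul_apply, LinearMap.sub_apply, stdF_one,
          stdF_zero, stdE_one, map_zero, zero_sub, stdK_one, stdK_pow_pred_one hN hq]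
        rw [← sub_smul, smul_smul, ← neg_sub q, mul_neg, inv_mul_cancel₀ hd, neg_smul, one_smul])

theorem stdRep_E (hN1 : 1 < N) : stdRep hN hq hN1 (E hN hq) = stdE k :=
  lift_gen hN hq _ _ _ _ _ _ _ _
theorem stdRep_F (hN1 : 1 < N) : stdRep hN hq hN1 (F hN hq) = stdF k :=
  lift_gen hN hq _ _ _ _ _ _ _ _
theorem stdRep_K (hN1 : 1 < N) : stdRep hN hq hN1 (K hN hq) = stdK q :=
  lift_gen hN hq _ _ _ _ _ _ _ _

theorem stdRep_isStandardBasis (hN1 : 1 < N) : IsStandardBasis (stdRep hN hq hN1) (stdBasis k) :=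
  ⟨by rw [stdRep_E, stdE_zero], by rw [stdRep_E, stdE_one], by rw [stdRep_K, stdK_zero],
    by rw [stdRep_K, stdK_one]⟩

/-- The invariant tensor of the standard module. -/
def stdTensor (q : k) : (Fin 2 → k) ⊗[k] (Fin 2 → k) :=
  stdBasis k 0 ⊗ₜ stdBasis k 1 - q • (stdBasis k 1 ⊗ₜ stdBasis k 0)

/-- The invariant form of the standard module. -/
def stdForm (q : k) : (Fin 2 → k) ⊗[k] (Fin 2 → k) →ₗ[k] k :=
  -- Invariance forces the (1, 0) entry to be -q times the (0, 1) entry; the former is normalized to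
  -- 1.
  ((stdBasis k).tensorProduct (stdBasis k)).constr k fun t => !![0, -q⁻¹; 1, 0] t.1 t.2

theorem stdForm_apply (i j : Fin 2) :
    stdForm q (stdBasis k i ⊗ₜ stdBasis k j) = !![0, -q⁻¹; 1, 0] i j := by
  rw [← Module.Basis.tensorProduct_apply, stdForm, Module.Basis.constr_basis]

variable {hN hq}

/-- Invariance of a tensor can be checked on generators. -/
theorem isInvariantTensor_of_gen {ρ : SmallQuantumSl2 hN hq →ₐ[k] Module.End k V} {c : V ⊗[k] V}
    (h : ∀ g, tensorRep ρ (comulHom hN hq (gen hN hq g)) c = counitHom hN hq (gen hN hq g) • c) :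
    IsInvariantTensor ρ c := by
  intro x
  rw [comul_eq, counit_eq]
  have hx : x ∈ Algebra.adjoin k (Set.range (gen hN hq)) := by rw [adjoin_gen]; trivial
  induction hx using Algebra.adjoin_induction with
  | mem x hx => obtain ⟨g, rfl⟩ := hx; exact h g
  | algebraMap r =>
    simp only [AlgHom.commutes]
    rfl
  | add x y _ _ hx hy => simp only [map_add, LinearMap.add_apply, hx, hy, add_smul]
  | mul x y _ _ hx hy =>
    simp only [map_mul, Module.End.mul_apply, hx, hy, map_smul, smul_smul]
    rw [mul_comm]

/-- Invariance of a form can be checked on generators. -/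
theorem isInvariantForm_of_gen {ρ : SmallQuantumSl2 hN hq →ₐ[k] Module.End k V}
    {β : V ⊗[k] V →ₗ[k] k} (h : ∀ g y, β (tensorRep ρ (comulHom hN hq (gen hN hq g)) y)
      = counitHom hN hq (gen hN hq g) * β y) :
    IsInvariantForm ρ β := by
  intro x
  simp only [comul_eq, counit_eq]
  have hx : x ∈ Algebra.adjoin k (Set.range (gen hN hq)) := by rw [adjoin_gen]; trivial
  induction hx using Algebra.adjoin_induction with
  | mem x hx => obtain ⟨g, rfl⟩ := hx; exact h g
  | algebraMap r =>
    intro y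
    simp only [AlgHom.commutes, Module.algebraMap_end_apply, map_smul]
    rfl
  | add x y _ _ hx hy => simp only [map_add, LinearMap.add_apply, hx, hy, add_mul, implies_true]
  | mul x y _ _ hx hy =>
    simp only [map_mul, Module.End.mul_apply, hx, hy, mul_assoc, implies_true]

theorem stdTensor_isInvariant (hN1 : 1 < N) :
    IsInvariantTensor (stdRep hN hq hN1) (stdTensor q) := by
  have h0 := q_ne_zero hN hq
  refine isInvariantTensor_of_gen fun g => ?_
  cases g
  · rw [comulHom_E, counitHom_E, zero_smul, stdTensor]
    simp only [map_add, map_sub, map_smul, LinearMap.add_apply, tensorRep_tmul, stdRep_E, stdRep_K,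
      map_one, Module.End.one_apply, stdE_zero, stdE_one, stdK_zero, stdK_one,
      TensorProduct.zero_tmul, TensorProduct.tmul_zero, TensorProduct.smul_tmul', zero_add, add_zero, sub_self]
  · rw [comulHom_F, counitHom_F, zero_smul, stdTensor]
    simp only [map_add, map_sub, map_smul, LinearMap.add_apply, tensorRep_tmul, stdRep_F, stdRep_K,
      map_pow, stdK_pow_pred_zero hN hq, stdK_pow_pred_one hN hq,
      map_one, Module.End.one_apply, stdF_zero, stdF_one, TensorProduct.tmul_smul,
      TensorProduct.zero_tmul, TensorProduct.tmul_zero, smul_zero, TensorProduct.smul_tmul',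
      zero_add, add_zero, sub_self]
  · rw [comulHom_K, counitHom_K, one_smul, stdTensor]
    simp only [map_sub, map_smul, tensorRep_tmul, stdRep_K, stdK_zero, stdK_one,
      TensorProduct.tmul_smul, TensorProduct.smul_tmul', smul_smul, mul_inv_cancel₀ h0,
      inv_mul_cancel₀ h0, one_smul]

theorem stdForm_isInvariant (hN1 : 1 < N) :
    IsInvariantForm (stdRep hN hq hN1) (stdForm q) := by
  have h0 := q_ne_zero hN hq
  have hext : ∀ {f g : (Fin 2 → k) ⊗[k] (Fin 2 → k) →ₗ[k] k},
      (∀ i j, f (stdBasis k i ⊗ₜ stdBasis k j) = g (stdBasis k i ⊗ₜ stdBasis k j)) → f = g := by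
    intro f g h
    refine ((stdBasis k).tensorProduct (stdBasis k)).ext fun t => ?_
    rw [Module.Basis.tensorProduct_apply]
    exact h _ _
  refine isInvariantForm_of_gen fun g y => ?_
  suffices h : stdForm q ∘ₗ tensorRep (stdRep hN hq hN1) (comulHom hN hq (gen hN hq g))
      = counitHom hN hq (gen hN hq g) • stdForm q from congrArg (fun f => f y) h
  refine hext fun i j => ?_
  rw [LinearMap.comp_apply, LinearMap.smul_apply]
  cases g
  · rw [comulHom_E, counitHom_E, zero_smul]
    match i, j with
    | 0, 0 | 0, 1 | 1, 0 | 1, 1 =>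
    simp only [map_add, map_smul, LinearMap.add_apply, tensorRep_tmul, stdRep_E, stdRep_K,
      map_one, Module.End.one_apply, stdE_zero, stdE_one, stdK_zero, stdK_one, map_zero,
      TensorProduct.zero_tmul, TensorProduct.tmul_zero, ← TensorProduct.smul_tmul',
      stdForm_apply]
    simp
  · rw [comulHom_F, counitHom_F, zero_smul]
    match i, j with
    | 0, 0 | 0, 1 | 1, 0 | 1, 1 =>
    simp only [map_add, map_smul, LinearMap.add_apply, tensorRep_tmul, stdRep_F, stdRep_K,
      map_pow, stdK_pow_pred_zero hN hq, stdK_pow_pred_one hN hq, map_zero,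
      map_one, Module.End.one_apply, stdF_zero, stdF_one, TensorProduct.tmul_smul,
      TensorProduct.zero_tmul, TensorProduct.tmul_zero, smul_zero, stdForm_apply]
    simp
  · rw [comulHom_K, counitHom_K, one_smul]
    match i, j with
    | 0, 0 | 0, 1 | 1, 0 | 1, 1 =>
    simp only [map_smul, tensorRep_tmul, stdRep_K, stdK_zero, stdK_one,
      TensorProduct.tmul_smul, ← TensorProduct.smul_tmul', stdForm_apply]
    simp [h0]

theorem stdForm_stdTensor : stdForm q (stdTensor q) = -(q + q⁻¹) := by
  rw [stdTensor, map_sub, map_smul, stdForm_apply, stdForm_apply]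
  simp [sub_eq_add_neg]

end TwoDimensional

end SmallQuantumSl2

/-- The twist is 1, and the inverse isomorphism has the direction required. -/
theorem gaugeEquivalent_of_hopfIsomorphic {k : Type*} [Field k] {H H' : Type*} [Ring H] [HopfAlgebra k H] [Ring H']
    [HopfAlgebra k H'] (h : HopfIsomorphic k H H') : GaugeEquivalent k H H' := by
  obtain ⟨e, -⟩ := h
  refine ⟨1, ⟨?_, ?_, ?_⟩, (e.symm : H' ≃ₐ[k] H), fun x => ?_, fun x => ?_⟩
  · simp
  · simp
  · simp [Algebra.TensorProduct.one_def]
  · exact CoalgHomClass.counit_comp_apply e.symm x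
  · rw [twistedComul, Units.val_one, inv_one, Units.val_one, one_mul, mul_one]
    exact (CoalgHomClass.map_comp_comul_apply e.symm x).symm

namespace SmallQuantumSl2

/-! ### Classification of the parameters -/

section Classification

variable {k : Type*} [Field k] {p q : k} {N : ℕ} {hN : Odd N}

/-- The standard module of u_p becomes a module of u_q through the isomorphism. Its form and tensor,
corrected by the twist, are invariant for u_q. The pairing and the zigzag are the same before and
after, but one computation expresses their ratio through p and the other through q. -/
theorem eq_or_eq_inv_of_gaugeEquivalent [CharZero k] (hN1 : 1 < N) {hp : IsPrimitiveRoot p N}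
    {hq : IsPrimitiveRoot q N}
    (h : GaugeEquivalent k (SmallQuantumSl2 hN hp) (SmallQuantumSl2 hN hq)) :
    p = q ∨ p = q⁻¹ := by
  obtain ⟨T, hT, φ, hε, hΔ⟩ := h
  have hp0 := q_ne_zero hN hp
  have hq0 := q_ne_zero hN hq
  set ρ := stdRep hN hp hN1 with hρ
  set σ : SmallQuantumSl2 hN hq →ₐ[k] Module.End k (Fin 2 → k) :=
    ρ.comp (φ : SmallQuantumSl2 hN hq →ₐ[k] SmallQuantumSl2 hN hp) with hσ
  have hσT : ∀ x : SmallQuantumSl2 hN hq, tensorRep σ (Coalgebra.comul (R := k) x)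
      = tensorRep ρ (T : _ ⊗[k] _) * tensorRep ρ (Coalgebra.comul (R := k) (φ x)) *
        tensorRep ρ (↑T⁻¹ : _ ⊗[k] _) := by
    intro x
    rw [← map_mul, ← map_mul]
    refine Eq.trans ?_ (congrArg (tensorRep ρ) (hΔ x).symm)
    generalize (Coalgebra.comul (R := k) x) = t
    induction t with
    | zero => simp
    | add x y hx hy => rw [map_add, map_add, map_add, hx, hy]
    | tmul a b => rfl
  have hTi : tensorRep ρ (↑T⁻¹ : _ ⊗[k] _) * tensorRep ρ (T : _ ⊗[k] _) = 1 := by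
    rw [← map_mul, Units.inv_mul, map_one]
  have hc : IsInvariantTensor σ (tensorRep ρ (T : _ ⊗[k] _) (stdTensor p)) := by
    intro x
    rw [hσT, ← Module.End.mul_apply, mul_assoc, hTi, mul_one, Module.End.mul_apply,
      stdTensor_isInvariant hN1 (φ x), map_smul, hε]
  have hβ : IsInvariantForm σ (stdForm p ∘ₗ tensorRep ρ (↑T⁻¹ : _ ⊗[k] _)) := by
    intro x y
    rw [hσT, LinearMap.comp_apply, ← Module.End.mul_apply, ← mul_assoc, ← mul_assoc, hTi, one_mul,
      Module.End.mul_apply, stdForm_isInvariant hN1 (φ x), hε]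
    rfl
  -- Preimages of the E and F of u_p do not commute; nothing is known about the images of the E and
  -- F of u_q.
  have hnc : ∃ x y, σ x * σ y ≠ σ y * σ x := by
    refine ⟨φ.symm (E hN hp), φ.symm (F hN hp), fun h => ?_⟩
    have h2 : stdE k * stdF k = stdF k * stdE k := by
      simpa [hσ, hρ, stdRep_E, stdRep_F] using h
    have h3 := congrArg (fun f : Module.End k (Fin 2 → k) => f (stdBasis k 0)) h2
    simp only [Module.End.mul_apply, stdF_zero, stdE_one, stdE_zero, map_zero] at h3
    exact (stdBasis k).ne_zero 0 h3
  obtain ⟨b, hb⟩ := exists_isStandardBasis hN1 (by simp) σ hnc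
  obtain ⟨s, hs1, hs2⟩ := hb.zigzag_eq ((isPrimitiveRoot_sq hN hq).ne_one hN1) hc hβ
  obtain ⟨t, ht1, ht2⟩ := (stdRep_isStandardBasis hN hp hN1).zigzag_eq
    ((isPrimitiveRoot_sq hN hp).ne_one hN1) (stdTensor_isInvariant hN1) (stdForm_isInvariant hN1)
  rw [LinearMap.comp_apply, ← Module.End.mul_apply, hTi, Module.End.one_apply] at hs1
  rw [zigzag_twist (stdForm_isInvariant hN1) (stdTensor_isInvariant hN1) hT] at hs2
  have hst : s = t := by
    have h1 := (hs2 (stdBasis k 0)).symm.trans (ht2 (stdBasis k 0))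
    exact smul_left_injective k ((stdBasis k).ne_zero 0) h1
  -- Needed for a nonzero scalar t: otherwise the comparison of the two formulas would be empty.
  have hpp : p + p⁻¹ ≠ 0 := by
    have h1 := one_add_ne_zero_of_pow_eq_one two_ne_zero hN (isPrimitiveRoot_sq hN hp).pow_eq_one
    intro h
    apply h1
    field_simp at h
    linear_combination h
  have ht0 : t ≠ 0 := by
    rintro rfl
    rw [stdForm_stdTensor, mul_zero, neg_eq_zero] at ht1
    exact hpp ht1
  have hpq : p + p⁻¹ = q + q⁻¹ := by
    have h1 : t * (p + p⁻¹ - (q + q⁻¹)) = 0 := by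
      rw [hst] at hs1
      linear_combination ht1 - hs1
    exact sub_eq_zero.mp ((mul_eq_zero.mp h1).resolve_left ht0)
  have hfac : (p - q) * (p * q - 1) = 0 := by
    field_simp at hpq
    linear_combination hpq
  rcases mul_eq_zero.mp hfac with h | h
  · exact Or.inl (sub_eq_zero.mp h)
  · exact Or.inr (eq_inv_of_mul_eq_one_left (sub_eq_zero.mp h))

/-! ### The isomorphism between inverse parameters -/

section InverseParameter

variable (hN) (hp : IsPrimitiveRoot p N) (hq : IsPrimitiveRoot q N) (hpq : p = q⁻¹)

theorem K_mul_F_pow : (K hN hq * F hN hq) ^ N = 0 := by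
  have h := neg_mul_pow_eq_zero (K_mul_F hN hq) (F_pow hN hq)
  rw [hN.neg_pow, neg_eq_zero] at h
  rw [K_mul_F, smul_pow, h, smul_zero]

theorem E_mul_Kinv_pow : (E hN hq * Kinv hN hq) ^ N = 0 := by
  have h := neg_mul_pow_eq_zero (Kinv_mul_E hN hq) (E_pow hN hq)
  rwa [hN.neg_pow, neg_eq_zero] at h

/-- The algebra map from `u_{q⁻¹}(sl₂)` to `u_q(sl₂)` with `E ↦ K F`, `F ↦ E K⁻¹` and `K ↦ K`. -/
def invHom : SmallQuantumSl2 hN hp →ₐ[k] SmallQuantumSl2 hN hq :=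
  lift hN hp (fun x => match x with
      | Sl2Gen.E => K hN hq * F hN hq
      | Sl2Gen.F => E hN hq * Kinv hN hq
      | Sl2Gen.K => K hN hq)
    (K_mul_F_pow hN hq) (E_mul_Kinv_pow hN hq) (K_pow hN hq)
    (by
      simp only
      rw [hpq, inv_pow, mul_assoc, ← mul_smul_comm, ← K_mul_F])
    (by
      simp only
      rw [hpq, inv_pow, inv_inv, ← mul_assoc, K_mul_E, smul_mul_assoc, mul_assoc, mul_assoc,
        K_mul_Kinv, Kinv_mul_K])
    (by
      simp only
      have h0 : q ^ 2 ≠ 0 := pow_ne_zero _ (q_ne_zero hN hq)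
      -- The images of EF and FE are FE and EF, so the commutator changes sign, as does q - q⁻¹
      -- under inversion of q.
      have h1 : K hN hq * F hN hq * (E hN hq * Kinv hN hq) = F hN hq * E hN hq := by
        rw [K_mul_F, smul_mul_assoc, mul_assoc, ← mul_assoc (K hN hq), K_mul_E, smul_mul_assoc,
          mul_smul_comm, smul_smul, inv_mul_cancel₀ h0, one_smul, mul_assoc, K_mul_Kinv, mul_one]
      have h2 : E hN hq * Kinv hN hq * (K hN hq * F hN hq) = E hN hq * F hN hq := by
        rw [mul_assoc, ← mul_assoc (Kinv hN hq), Kinv_mul_K, one_mul]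
      rw [h1, h2, ← neg_sub, E_mul_F, hpq, inv_inv, ← neg_smul, ← inv_neg, neg_sub])

theorem invHom_E : invHom hN hp hq hpq (E hN hp) = K hN hq * F hN hq :=
  lift_gen hN hp _ _ _ _ _ _ _ _
theorem invHom_F : invHom hN hp hq hpq (F hN hp) = E hN hq * Kinv hN hq :=
  lift_gen hN hp _ _ _ _ _ _ _ _
theorem invHom_K : invHom hN hp hq hpq (K hN hp) = K hN hq :=
  lift_gen hN hp _ _ _ _ _ _ _ _
theorem invHom_Kinv : invHom hN hp hq hpq (Kinv hN hp) = Kinv hN hq := by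
  rw [Kinv, map_pow, invHom_K]

theorem invHom_surjective : Function.Surjective (invHom hN hp hq hpq) := by
  rw [← AlgHom.range_eq_top, eq_top_iff, ← adjoin_gen, Algebra.adjoin_le_iff]
  rintro _ ⟨g, rfl⟩
  cases g
  · refine ⟨F hN hp * K hN hp, ?_⟩
    refine (map_mul (invHom hN hp hq hpq) _ _).trans ?_
    rw [invHom_F, invHom_K, mul_assoc, Kinv_mul_K, mul_one]
  · refine ⟨Kinv hN hp * E hN hp, ?_⟩
    refine (map_mul (invHom hN hp hq hpq) _ _).trans ?_
    rw [invHom_E, invHom_Kinv, ← mul_assoc, Kinv_mul_K, one_mul]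
  · exact ⟨K hN hp, invHom_K hN hp hq hpq⟩

/-- Composing with the analogous map in the other direction gives a surjective endomorphism of a
finite-dimensional space, hence an injective one. Neither the inverse nor the dimension has to be
computed. -/
theorem invHom_bijective [CharZero k] (hN1 : 1 < N) :
    Function.Bijective (invHom hN hp hq hpq) := by
  have : NeZero N := ⟨by omega⟩
  have : Module.Finite k (SmallQuantumSl2 hN hp) :=
    (finite_and_trace_antipode hN hp hN1 two_ne_zero).1
  have hqp : q = p⁻¹ := by rw [hpq, inv_inv]
  refine ⟨?_, invHom_surjective hN hp hq hpq⟩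
  have h : Function.Injective ((invHom hN hq hp hqp).comp (invHom hN hp hq hpq)).toLinearMap :=
    LinearMap.injective_iff_surjective.mpr
      ((invHom_surjective hN hq hp hqp).comp (invHom_surjective hN hp hq hpq))
  exact Function.Injective.of_comp (f := invHom hN hq hp hqp) h

theorem counitHom_invHom (x : SmallQuantumSl2 hN hp) :
    counitHom hN hq (invHom hN hp hq hpq x) = counitHom hN hp x := by
  suffices h : (counitHom hN hq).comp (invHom hN hp hq hpq) = counitHom hN hp from
    congrArg (fun f => f x) h
  refine algHom_ext fun g => ?_
  rw [AlgHom.comp_apply]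
  cases g
  · rw [invHom_E, map_mul, counitHom_F, counitHom_E, mul_zero]
  · rw [invHom_F, map_mul, counitHom_F, counitHom_E, zero_mul]
  · rw [invHom_K, counitHom_K, counitHom_K]

theorem comulHom_invHom (x : SmallQuantumSl2 hN hp) :
    comulHom hN hq (invHom hN hp hq hpq x) = Algebra.TensorProduct.map (invHom hN hp hq hpq)
      (invHom hN hp hq hpq) (comulHom hN hp x) := by
  suffices h : (comulHom hN hq).comp (invHom hN hp hq hpq) = (Algebra.TensorProduct.map
      (invHom hN hp hq hpq) (invHom hN hp hq hpq)).comp (comulHom hN hp) from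
    congrArg (fun f => f x) h
  refine algHom_ext fun g => ?_
  rw [AlgHom.comp_apply, AlgHom.comp_apply]
  cases g
  · rw [invHom_E, comulHom_E, map_mul, comulHom_K, comulHom_F, map_add,
      Algebra.TensorProduct.map_tmul, Algebra.TensorProduct.map_tmul, invHom_E, invHom_K, map_one,
      mul_add, Algebra.TensorProduct.tmul_mul_tmul, Algebra.TensorProduct.tmul_mul_tmul,
      K_mul_Kinv, mul_one]
  · rw [invHom_F, comulHom_F, map_mul, comulHom_Kinv, comulHom_E, map_add,
      Algebra.TensorProduct.map_tmul, Algebra.TensorProduct.map_tmul, invHom_F, invHom_Kinv,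
      map_one, add_mul, Algebra.TensorProduct.tmul_mul_tmul, Algebra.TensorProduct.tmul_mul_tmul,
      K_mul_Kinv, one_mul]
  · rw [invHom_K, comulHom_K, comulHom_K, Algebra.TensorProduct.map_tmul, invHom_K]

theorem antipodeLin_invHom (x : SmallQuantumSl2 hN hp) :
    invHom hN hp hq hpq (antipodeLin hN hp x) = antipodeLin hN hq (invHom hN hp hq hpq x) := by
  have hx : x ∈ Algebra.adjoin k (Set.range (gen hN hp)) := by rw [adjoin_gen]; trivial
  induction hx using Algebra.adjoin_induction with
  | mem x hx =>
    obtain ⟨g, rfl⟩ := hx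
    cases g
    · rw [antipodeLin_E, map_neg, map_mul, invHom_Kinv, invHom_E, antipodeLin_mul, antipodeLin_F,
        antipodeLin_K, ← mul_assoc, Kinv_mul_K, one_mul, neg_mul, mul_assoc, K_mul_Kinv, mul_one]
    · rw [antipodeLin_F, map_neg, map_mul, invHom_K, invHom_F, antipodeLin_mul, antipodeLin_E,
        antipodeLin_Kinv, mul_assoc, Kinv_mul_K, mul_one, mul_neg, ← mul_assoc, K_mul_Kinv,
        one_mul]
    · rw [antipodeLin_K, invHom_Kinv, invHom_K, antipodeLin_K]
  | algebraMap r =>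
    simp only [Algebra.algebraMap_eq_smul_one, map_smul, antipodeLin_one, map_one]
  | add x y _ _ hx hy => simp only [map_add, hx, hy]
  | mul x y _ _ hx hy => rw [antipodeLin_mul, map_mul, map_mul, antipodeLin_mul, hx, hy]

theorem hopfIsomorphic_inv [CharZero k] (hN1 : 1 < N) (hpq : p = q⁻¹) :
    HopfIsomorphic k (SmallQuantumSl2 hN hp) (SmallQuantumSl2 hN hq) :=
  ⟨BialgEquiv.ofBijective (BialgHom.ofAlgHom (invHom hN hp hq hpq)
      (AlgHom.ext (counitHom_invHom hN hp hq hpq))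
      (AlgHom.ext fun x => (comulHom_invHom hN hp hq hpq x).symm))
    (invHom_bijective hN hp hq hpq hN1), antipodeLin_invHom hN hp hq hpq⟩

end InverseParameter

end Classification

end SmallQuantumSl2

end

/-! ### The theorem -/

theorem mainTheorem8 {k : Type*} [Field k] [IsAlgClosed k] [CharZero k]
    {N : ℕ} (hN : Odd N) (hN1 : 1 < N) {p q : k}
    (hp : IsPrimitiveRoot p N) (hq : IsPrimitiveRoot q N) :
    (Module.Finite k (SmallQuantumSl2 hN hq) ∧
      hopfIndicator k (SmallQuantumSl2 hN hq) 2 = 4 / ((1 + q) * (1 + q⁻¹))) ∧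
    (GaugeEquivalent k (SmallQuantumSl2 hN hp) (SmallQuantumSl2 hN hq) ↔
      HopfIsomorphic k (SmallQuantumSl2 hN hp) (SmallQuantumSl2 hN hq)) ∧
    (HopfIsomorphic k (SmallQuantumSl2 hN hp) (SmallQuantumSl2 hN hq) ↔
      (p = q ∨ p = q⁻¹)) := by
  have : NeZero N := ⟨by omega⟩
  have hiso : p = q ∨ p = q⁻¹ →
      HopfIsomorphic k (SmallQuantumSl2 hN hp) (SmallQuantumSl2 hN hq) := by
    rintro (rfl | h)
    · exact ⟨BialgEquiv.refl k _, fun x => rfl⟩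
    · exact SmallQuantumSl2.hopfIsomorphic_inv hN hp hq hN1 h
  have hgauge := SmallQuantumSl2.eq_or_eq_inv_of_gaugeEquivalent (hN := hN) hN1 (hp := hp)
    (hq := hq)
  refine ⟨?_, ⟨fun h => hiso (hgauge h), gaugeEquivalent_of_hopfIsomorphic⟩,
    fun h => hgauge (gaugeEquivalent_of_hopfIsomorphic h), hiso⟩
  rw [SmallQuantumSl2.hopfIndicator_two]
  exact SmallQuantumSl2.finite_and_trace_antipode hN hq hN1 two_ne_zero
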